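/- Let $U\subseteq\mathbb R^n$ be open, with coordinates $u^1,\dots,u^n$, and let $g^{ij}(u)$ be a smooth, symmetric, nondegenerate (of any signature) contravariant metric on $U$ that is flat, with Levi-Civita connection $\nabla$ and Christoffel symbols $\Gamma^j_{sk}$. Let $h$ be a smooth function on $U$ and consider the Hamiltonian system $$u^i_t=v^i_j(u)\,u^j_x=J^{ij}\frac{\partial h}{\partial u^j},\qquad J^{ij}=g^{ij}\frac{d}{dx}-g^{is}\Gamma^j_{sk}u^k_x ,\qquad v^i_j=\nabla^i\nabla_jh .$$ Let $B(u)\,dx+A(u)\,dt$ be a conservation law of this system ($A,B$ smooth; $B_t=A_x$ by virtue of the system) with $B\neq0$ on $U$. Put $\tilde g^{ij}=B^2g^{ij}$, let $\tilde\nabla$, $\tilde\Gamma$ be the Levi-Civita connection of $\tilde g$ and its Christoffel symbols, and let $$\tilde w^i_j=B\,\nabla^i\nabla_jB-\tfrac12(\nabla B)^2\delta^i_j,\qquad (\nabla B)^2=g^{ij}\,\partial_iB\,\partial_jB,\qquad \tilde h=h/B .$$ 1. Under the reciprocal transformation $d\tilde x=B\,dx+A\,dt$, $\tilde t=t$, solutions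 of the system become solutions of $u^i_t=\tilde v^i_ju^j_{\tilde x}$ with $\tilde v^i_j=B\,\nabla^i\nabla_jh-A\,\delta^i_j$. 2. The operator $$\tilde J^{ij}=\tilde g^{ij}\frac{d}{d\tilde x}-\tilde g^{is}\tilde\Gamma^j_{sk}u^k_{\tilde x}+\tilde w^i_ku^k_{\tilde x}\Big(\frac{d}{d\tilde x}\Big)^{-1}u^j_{\tilde x}+u^i_{\tilde x}\Big(\frac{d}{d\tilde x}\Big)^{-1}\tilde w^j_ku^k_{\tilde x}$$ is Hamiltonian: the bracket $\{F,K\}=\int\frac{\delta F}{\delta u^i}\tilde J^{ij}\frac{\delta K}{\delta u^j}\,d\tilde x$, with $(d/d\tilde x)^{-1}f=\frac12\big(\int_{-\infty}^{\tilde x}f-\int_{\tilde x}^{\infty}f\big)$, is skew-symmetric and satisfies the Jacobi identity on smooth fields $u:\mathbb R\to U$ (for functionals with compactly supported variational derivatives). 3. The transformed system is Hamiltonian with this operator and the density $\tilde h$: $$\tilde v^i_j\,u^j_{\tilde x}=\tilde J^{ij}\frac{\partial\tilde h}{\partial u^j}.$$ Here $(d/d\tilde x)^{-1}\big(u^j_{\tilde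 x}\partial_j\tilde h\big)=\tilde h$ and $(d/d\tilde x)^{-1}\big(\tilde w^j_ku^k_{\tilde x}\partial_j\tilde h\big)=P(u)$, where $P$ is a smooth function on $U$ with $\partial_kP=\tilde w^j_k\partial_j\tilde h$ (part of the claim is that a suitable $P$ exists). 4. The metric $\tilde g$ is conformally flat, and $\tilde J$ is an operator of conformally flat type: $\tilde g_{is}\tilde w^s_j=\tilde g_{js}\tilde w^s_i$, $\ \tilde\nabla_k\tilde w^i_j=\tilde\nabla_j\tilde w^i_k$, and the curvature tensor of $\tilde g$ is $$\tilde R^{ij}_{kl}=\tilde w^i_k\delta^j_l+\tilde w^j_l\delta^i_k-\tilde w^j_k\delta^i_l-\tilde w^i_l\delta^j_k ,$$ where the sign of the curvature is such that $R^{ij}_{kl}=c(\delta^i_k\delta^j_l-\delta^i_l\delta^j_k)$ for a metric of constant curvature $c$. -/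

import Mathlib

open scoped ContDiff

noncomputable section

namespace HydroRecip

/-! Tensor calculus on an open subset of `ℝⁿ`; a metric is given by its contravariant
components `G p i j = g^{ij}(p)`. -/

/-- The coordinate space of the field variables `u¹, …, uⁿ`. -/
abbrev V (n : ℕ) : Type := Fin n → ℝ

/-- The partial derivative `∂f/∂uᵏ` at `p`. -/
def pd {n : ℕ} (k : Fin n) (f : V n → ℝ) (p : V n) : ℝ :=
  fderiv ℝ f p (Pi.single k 1)

/-- A smooth, symmetric, nondegenerate (of any signature) contravariant metric on `U`. -/
structure IsMetric {n : ℕ} (U : Set (V n)) (G : V n → Matrix (Fin n) (Fin n) ℝ) : Prop where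
  smooth : ∀ i j, ContDiffOn ℝ ∞ (fun p => G p i j) U
  symm : ∀ p ∈ U, ∀ i j, G p i j = G p j i
  nondeg : ∀ p ∈ U, (G p).det ≠ 0

/-- The Christoffel symbols `Γ^j_{sk}` of the Levi-Civita connection of the metric; the covariant
components `g_{ij}` are the entries of the inverse matrix `(G p)⁻¹`. -/
def christoffel {n : ℕ} (G : V n → Matrix (Fin n) (Fin n) ℝ) (p : V n) (j s k : Fin n) : ℝ :=
  (1 / 2) * ∑ m, G p j m *
    (pd s (fun q => (G q)⁻¹ m k) p + pd k (fun q => (G q)⁻¹ m s) p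
      - pd m (fun q => (G q)⁻¹ s k) p)

/-- The Riemann tensor
`R^i_{jkl} = ∂_k Γ^i_{lj} - ∂_l Γ^i_{kj} + Γ^i_{km} Γ^m_{lj} - Γ^i_{lm} Γ^m_{kj}`. -/
def riemann {n : ℕ} (G : V n → Matrix (Fin n) (Fin n) ℝ) (p : V n) (i j k l : Fin n) : ℝ :=
  pd k (fun q => christoffel G q i l j) p - pd l (fun q => christoffel G q i k j) p
    + ∑ m, (christoffel G p i k m * christoffel G p m l j
      - christoffel G p i l m * christoffel G p m k j)

/-- The curvature with two raised indices, `R^{ij}_{kl} = g^{jm} R^i_{mkl}`; with this sign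
`R^{ij}_{kl} = c (δ^i_k δ^j_l - δ^i_l δ^j_k)` for a metric of constant curvature `c`. -/
def curvature {n : ℕ} (G : V n → Matrix (Fin n) (Fin n) ℝ) (p : V n) (i j k l : Fin n) : ℝ :=
  ∑ m, G p j m * riemann G p i m k l

/-- The metric is flat on `U`. -/
def IsFlat {n : ℕ} (U : Set (V n)) (G : V n → Matrix (Fin n) (Fin n) ℝ) : Prop :=
  ∀ p ∈ U, ∀ i j k l, riemann G p i j k l = 0

/-- The metric is conformally flat on `U`: near each point a positive multiple of it is flat. -/
def IsConformallyFlat {n : ℕ} (U : Set (V n)) (G : V n → Matrix (Fin n) (Fin n) ℝ) : Prop :=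
  ∀ p ∈ U, ∃ W : Set (V n), IsOpen W ∧ p ∈ W ∧ W ⊆ U ∧ ∃ c : V n → ℝ,
    ContDiffOn ℝ ∞ c W ∧ (∀ q ∈ W, 0 < c q) ∧
      IsMetric W (fun q => c q • G q) ∧ IsFlat W (fun q => c q • G q)

/-- `∇^i ∇_j f = g^{is} (∂_s ∂_j f - Γ^k_{sj} ∂_k f)`. -/
def hess {n : ℕ} (G : V n → Matrix (Fin n) (Fin n) ℝ) (f : V n → ℝ) (p : V n) :
    Matrix (Fin n) (Fin n) ℝ :=
  Matrix.of fun i j =>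
    ∑ s, G p i s * (pd s (fun q => pd j f q) p - ∑ k, christoffel G p k s j * pd k f p)

/-- `(∇f)² = g^{ij} ∂_i f ∂_j f`. -/
def gradSq {n : ℕ} (G : V n → Matrix (Fin n) (Fin n) ℝ) (f : V n → ℝ) (p : V n) : ℝ :=
  ∑ i, ∑ j, G p i j * pd i f p * pd j f p

/-- The covariant derivative `∇_k w^i_j` of an affinor `w p i j = w^i_j(p)`. -/
def covDeriv {n : ℕ} (G w : V n → Matrix (Fin n) (Fin n) ℝ) (p : V n) (k i j : Fin n) : ℝ :=
  pd k (fun q => w q i j) p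
    + ∑ m, (christoffel G p i k m * w p m j - christoffel G p m k j * w p i m)

/-! Operators of hydrodynamic type. -/

/-- The skew-symmetric inverse of `d/dx`:
`(d/dx)⁻¹ f (x) = ½ (∫_{-∞}^x f - ∫_x^∞ f)`. -/
def dInv (f : ℝ → ℝ) (x : ℝ) : ℝ :=
  (1 / 2) * ((∫ y in Set.Iic x, f y) - ∫ y in Set.Ioi x, f y)

/-- The data of an operator of hydrodynamic type with a tail of `m` terms,
`g^{ij} d/dx - g^{is} Γ^j_{sk} u_x^k + ∑_α a_α^i_k u_x^k (d/dx)⁻¹ b_α^j_l u_x^l`,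
where `Γ` is the Levi-Civita connection of `g`. It is local if `m = 0`. -/
structure HydroOp (n m : ℕ) where
  /-- the contravariant metric -/
  metric : V n → Matrix (Fin n) (Fin n) ℝ
  /-- the affinors to the left of `(d/dx)⁻¹` -/
  left : Fin m → V n → Matrix (Fin n) (Fin n) ℝ
  /-- the affinors to the right of `(d/dx)⁻¹` -/
  right : Fin m → V n → Matrix (Fin n) (Fin n) ℝ

namespace HydroOp

variable {n m : ℕ}

/-- The function `b_α^j_l u_x^l ψ_j` of `x`, to which `(d/dx)⁻¹` is applied in the
`α`-th term of the tail. -/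
def integrand (O : HydroOp n m) (u ψ : ℝ → V n) (α : Fin m) (x : ℝ) : ℝ :=
  ∑ j, ∑ l, O.right α (u x) j l * deriv u x l * ψ x j

/-- The value of the operator at the field `u` on the covector field `ψ`, when `φ α` is the
primitive chosen for `O.integrand u ψ α`. -/
def act (O : HydroOp n m) (u ψ : ℝ → V n) (φ : Fin m → ℝ → ℝ) (x : ℝ) : V n := fun i =>
  (∑ j, O.metric (u x) i j * deriv ψ x j)
    - (∑ j, ∑ s, ∑ k,
        O.metric (u x) i s * christoffel O.metric (u x) j s k * deriv u x k * ψ x j)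
    + ∑ α, (∑ k, O.left α (u x) i k * deriv u x k) * φ α x

/-- The operator on compactly supported covector fields `ψ`, where `(d/dx)⁻¹` is the
skew-symmetric primitive. -/
def op (O : HydroOp n m) (u ψ : ℝ → V n) : ℝ → V n :=
  O.act u ψ (fun α => dInv (O.integrand u ψ α))

end HydroOp

/-- The local operator `g^{ij} d/dx - g^{is} Γ^j_{sk} u_x^k`. -/
def localOp {n : ℕ} (G : V n → Matrix (Fin n) (Fin n) ℝ) : HydroOp n 0 where
  metric := G
  left := ![]
  right := ![]

/-- The operator of conformally flat type `g^{ij} d/dx - g^{is} Γ^j_{sk} u_x^k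
+ w^i_k u_x^k (d/dx)⁻¹ u_x^j + u_x^i (d/dx)⁻¹ w^j_k u_x^k`. -/
def conformalOp {n : ℕ} (G w : V n → Matrix (Fin n) (Fin n) ℝ) : HydroOp n 2 where
  metric := G
  left := ![w, fun _ => 1]
  right := ![fun _ => 1, w]

/-- The pairing `∫ ξ_i v^i dx`. -/
def pairing {n : ℕ} (ξ v : ℝ → V n) : ℝ := ∫ x, ∑ i, ξ x i * v x i

/-- Smooth compactly supported covector fields. -/
def IsTest {n : ℕ} (ξ : ℝ → V n) : Prop := ContDiff ℝ ∞ ξ ∧ HasCompactSupport ξ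

/-- `J` is a Hamiltonian operator on the smooth fields `u : ℝ → U`: the bracket
`{F, K} = ∫ δF/δuⁱ J^{ij} δK/δuʲ dx` is skew-symmetric and satisfies the Jacobi identity.
For the functionals `F_ξ(u) = ∫ ξ_i(x) uⁱ(x) dx` one has `{F_η, F_ζ}(u) = ∫ η · J(u) ζ dx` and
`{F_ξ, K}(u) = - d/dε K(u + ε J(u) ξ)` at `ε = 0`. These functionals determine the bracket (its
distribution kernel `{uⁱ(x), uʲ(y)}`), and the Jacobi identity for them is the identity for all. -/
def IsHamiltonianOperator {n : ℕ} (U : Set (V n)) (J : (ℝ → V n) → (ℝ → V n) → ℝ → V n) : Prop :=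
  ∀ u : ℝ → V n, ContDiff ℝ ∞ u → (∀ x, u x ∈ U) →
    (∀ ξ, IsTest ξ → ContDiff ℝ ∞ (J u ξ)) ∧
    (∀ ξ η, IsTest ξ → IsTest η → pairing ξ (J u η) = - pairing η (J u ξ)) ∧
    (∀ ξ η ζ, IsTest ξ → IsTest η → IsTest ζ → ∃ a b c : ℝ,
      HasDerivAt (fun ε : ℝ => pairing η (J (u + ε • J u ξ) ζ)) a 0 ∧
      HasDerivAt (fun ε : ℝ => pairing ζ (J (u + ε • J u η) ξ)) b 0 ∧
      HasDerivAt (fun ε : ℝ => pairing ξ (J (u + ε • J u ζ) η)) c 0 ∧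
      a + b + c = 0)

/-- The covector field `∂h/∂uʲ` along `u`. -/
def gradAlong {n : ℕ} (h : V n → ℝ) (u : ℝ → V n) (x : ℝ) : V n := fun j => pd j h (u x)

/-- The system `u_t = v(u) u_x` is the Hamiltonian system `u_t^i = J^{ij} ∂h/∂uʲ` on `U`, where
`J` is the operator `O` and `(d/dx)⁻¹`, applied to the expressions `b_α^j_l u_x^l ∂h/∂uʲ`, gives
the functions `Q α` of `u`, whose `x`-derivatives they are. -/
structure IsHamiltonianSystem {n m : ℕ} (U : Set (V n)) (v : V n → Matrix (Fin n) (Fin n) ℝ)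
    (O : HydroOp n m) (h : V n → ℝ) (Q : Fin m → V n → ℝ) : Prop where
  smooth : ∀ α, ContDiffOn ℝ ∞ (Q α) U
  primitive : ∀ (u : ℝ → V n) (x : ℝ), ContDiffAt ℝ ∞ u x → u x ∈ U →
    ∀ α, HasDerivAt (fun y => Q α (u y)) (O.integrand u (gradAlong h u) α x) x
  flow : ∀ (u : ℝ → V n) (x : ℝ), ContDiffAt ℝ ∞ u x → u x ∈ U →
    (v (u x)).mulVec (deriv u x) = O.act u (gradAlong h u) (fun α y => Q α (u y)) x

/-- `B(u) dx + A(u) dt` is a conservation law of `u_t = v(u) u_x`: it is closed by virtue of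
the system, that is, `B_t = A_x` for all values `η` of `u_x`, once `u_t = v η` is inserted. -/
def IsConservationLaw {n : ℕ} (U : Set (V n)) (v : V n → Matrix (Fin n) (Fin n) ℝ)
    (B A : V n → ℝ) : Prop :=
  ∀ p ∈ U, ∀ η : V n, fderiv ℝ B p ((v p).mulVec η) = fderiv ℝ A p η

/-- `u` is a smooth solution with values in `U` of `u_t = v(u) u_x` on the open set `D` of the
`(x, t)`-plane. -/
structure IsSolution {n : ℕ} (U : Set (V n)) (v : V n → Matrix (Fin n) (Fin n) ℝ)
    (D : Set (ℝ × ℝ)) (u : ℝ × ℝ → V n) : Prop where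
  isOpen : IsOpen D
  smooth : ContDiffOn ℝ ∞ u D
  mem : ∀ z ∈ D, u z ∈ U
  eq : ∀ z ∈ D, deriv (fun t => u (z.1, t)) z.2 =
    (v (u z)).mulVec (deriv (fun x => u (x, z.2)) z.1)

/-- `X` is the new variable `x̃`, with `dx̃ = B(u) dx + A(u) dt` and `t̃ = t`, and `u'` is the
field `u` on `D`, expressed through `(x̃, t)`. -/
structure IsReciprocal {n : ℕ} (B A : V n → ℝ) (D : Set (ℝ × ℝ)) (u : ℝ × ℝ → V n)
    (X : ℝ × ℝ → ℝ) (u' : ℝ × ℝ → V n) : Prop where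
  dX : ∀ z ∈ D, HasFDerivAt X
    (B (u z) • ContinuousLinearMap.fst ℝ ℝ ℝ + A (u z) • ContinuousLinearMap.snd ℝ ℝ ℝ) z
  field : ∀ z ∈ D, u' (X z, z.2) = u z

/-- The matrix `B v - A E` of the transformed system. -/
def newMatrix {n : ℕ} (v : V n → Matrix (Fin n) (Fin n) ℝ) (B A : V n → ℝ) (p : V n) :
    Matrix (Fin n) (Fin n) ℝ :=
  B p • v p - A p • (1 : Matrix (Fin n) (Fin n) ℝ)

/-- The transformed contravariant metric `B² g^{ij}`. -/
def newMetric {n : ℕ} (G : V n → Matrix (Fin n) (Fin n) ℝ) (B : V n → ℝ) (p : V n) :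
    Matrix (Fin n) (Fin n) ℝ :=
  (B p) ^ 2 • G p

/-- The affinor `B ∇^i ∇_j B - ½ (∇B)² δ^i_j` of the new tail. -/
def newTail {n : ℕ} (G : V n → Matrix (Fin n) (Fin n) ℝ) (B : V n → ℝ) (p : V n) :
    Matrix (Fin n) (Fin n) ℝ :=
  B p • hess G B p - ((1 / 2) * gradSq G B p) • (1 : Matrix (Fin n) (Fin n) ℝ)

end HydroRecip

end

noncomputable section

namespace HydroRecip

open scoped Topology Matrix

/-! ### Calculus of partial derivatives on an open set. -/

section PartialDerivatives

variable {n : ℕ} {U : Set (V n)} {p : V n} {f g : V n → ℝ} {k : Fin n}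

/-! Everything rests on how the Levi-Civita connection changes under `g ↦ B² g`
(`christoffel_newMetric`). The Riemann tensor then changes by terms in `∇∇B / B` and `(∇B)² / B²`
(`riemann_newMetric`). Since `g` is flat only these survive, and raising an index with `B² g` turns
them into the affinor `w = B ∇∇B - ½ (∇B)²` (`curvature_newMetric`). Flatness also makes third
covariant derivatives of `B` symmetric, which together with the conformal correction gives the
Codazzi equation (`covDeriv_newTail`). Conformal flatness is immediate, because `B⁻²` times the new
metric is `g`.

The local system has matrix `∇^i ∇_j h`. Write `h = B f`. The Leibniz rule for the Hessian and the
conformal change of the Hessian of `f` show that `B v - A` is the new Hessian of `f`, plus `f w`,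
plus a function `P` times the identity. This determines `P`, and `∂_k P = w^j_k ∂_j f` is then the
conservation law `∂_k A = ∂_m B v^m_k` in disguise (`isHamiltonianSystem_newMatrix`). The
transformation of solutions is the chain rule for `(x, t) ↦ (x̃, t)`, a local diffeomorphism because
`B ≠ 0` (`IsReciprocal.isSolution`).

The Hamiltonian property holds for every operator of conformally flat type with symmetric `w`, the
Codazzi equation and the curvature formula (`isHamiltonianOperator_conformalOp`). On test covectors
`J ζ = g ∇ζ + a w u_x + b u_x`, where `∇` is the covariant derivative along the curve and `a`, `b`
are the skew primitives of `ζ · u_x` and `ζ · w u_x`. Skew-symmetry follows from metric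
compatibility and from integration by parts for the primitives. For the Jacobi identity, the
variation of `∫ η · J ζ` along `X = J ξ` is written with primitives of unvaried quantities only
(`hasDerivAt_pairing_op`). Its integrand is then a total derivative plus a remainder
(`bracket_integrand_eq`): differentiating the primitives produces products of pairings, and these
are exactly what the curvature formula absorbs, while the Codazzi equation removes the derivatives
of `w`. The total derivative integrates to zero, and the remainders cancel in the cyclic sum by
vanishing torsion and the symmetry of `w g` (`bracketRemainder_cyclic`). -/

theorem contDiffOn_differentiableAt (hU : IsOpen U) (hf : ContDiffOn ℝ ∞ f U) (hp : p ∈ U) :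
    DifferentiableAt ℝ f p :=
  (hf.contDiffAt (hU.mem_nhds hp)).differentiableAt (by simp)

theorem pd_add (hf : DifferentiableAt ℝ f p) (hg : DifferentiableAt ℝ g p) :
    pd k (fun q => f q + g q) p = pd k f p + pd k g p := by
  simp [pd, fderiv_fun_add hf hg]

theorem pd_sub (hf : DifferentiableAt ℝ f p) (hg : DifferentiableAt ℝ g p) :
    pd k (fun q => f q - g q) p = pd k f p - pd k g p := by
  simp [pd, fderiv_fun_sub hf hg]

theorem pd_mul (hf : DifferentiableAt ℝ f p) (hg : DifferentiableAt ℝ g p) :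
    pd k (fun q => f q * g q) p = pd k f p * g p + f p * pd k g p := by
  simp [pd, fderiv_fun_mul hf hg]; ring

theorem pd_const (c : ℝ) : pd k (fun _ => c) p = 0 := by
  simp [pd]

theorem pd_const_mul (c : ℝ) (hf : DifferentiableAt ℝ f p) :
    pd k (fun q => c * f q) p = c * pd k f p := by
  rw [pd_mul (by fun_prop) hf, pd_const]; ring

theorem pd_inv (hf : DifferentiableAt ℝ f p) (h0 : f p ≠ 0) :
    pd k (fun q => (f q)⁻¹) p = - pd k f p / f p ^ 2 := by
  have h := ((hasDerivAt_inv h0).comp_hasFDerivAt p hf.hasFDerivAt).fderiv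
  change fderiv ℝ (Inv.inv ∘ f) p _ = _
  rw [h]
  simp [pd]; ring

theorem pd_div (hf : DifferentiableAt ℝ f p) (hg : DifferentiableAt ℝ g p) (h0 : g p ≠ 0) :
    pd k (fun q => f q / g q) p = pd k f p / g p - f p * pd k g p / g p ^ 2 := by
  simp only [div_eq_mul_inv (f _)]
  rw [pd_mul hf (hg.fun_inv h0), pd_inv hg h0]; ring

theorem pd_sum {ι : Type*} (s : Finset ι) {F : ι → V n → ℝ}
    (hF : ∀ i ∈ s, DifferentiableAt ℝ (F i) p) :
    pd k (fun q => ∑ i ∈ s, F i q) p = ∑ i ∈ s, pd k (F i) p := by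
  simp [pd, fderiv_fun_sum hF]

theorem pd_congr (hU : IsOpen U) (hp : p ∈ U) (h : ∀ q ∈ U, f q = g q) :
    pd k f p = pd k g p := by
  have : f =ᶠ[𝓝 p] g := Filter.eventually_of_mem (hU.mem_nhds hp) h
  simp only [pd, this.fderiv_eq]

theorem contDiffOn_pd (hU : IsOpen U) (hf : ContDiffOn ℝ ∞ f U) (k : Fin n) :
    ContDiffOn ℝ ∞ (fun q => pd k f q) U :=
  (hf.fderiv_of_isOpen hU (m := ∞) (by simp)).clm_apply contDiffOn_const

theorem pd_comm (hU : IsOpen U) (hf : ContDiffOn ℝ ∞ f U) (hp : p ∈ U) (k l : Fin n) :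
    pd k (fun q => pd l f q) p = pd l (fun q => pd k f q) p := by
  have hc := hf.contDiffAt (hU.mem_nhds hp)
  have hs := hc.isSymmSndFDerivAt (by simp; exact WithTop.coe_le_coe.2 (le_top : (2 : ℕ∞) ≤ ⊤))
  have hd : DifferentiableAt ℝ (fderiv ℝ f) p :=
    (hc.fderiv_right (m := ∞) (by simp)).differentiableAt (by simp)
  have key : ∀ a b : V n, fderiv ℝ (fun q => fderiv ℝ f q a) p b = fderiv ℝ (fderiv ℝ f) p b a := by
    intro a b
    rw [fderiv_clm_apply hd (by fun_prop)]
    simp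
  simp only [pd, key]
  exact hs.eq _ _

theorem fderiv_eq_sum_pd (f : V n → ℝ) (p X : V n) :
    fderiv ℝ f p X = ∑ k, pd k f p * X k := by
  conv_lhs => rw [← Finset.univ_sum_single X, map_sum]
  refine Finset.sum_congr rfl fun k _ => ?_
  have : Pi.single k (X k) = X k • (Pi.single k 1 : V n) := by
    rw [← Pi.single_smul]; simp
  rw [this, map_smul, pd, smul_eq_mul, mul_comm]

theorem hasDerivAt_comp_curve (hf : DifferentiableAt ℝ f p) {γ : ℝ → V n} {t : ℝ} {X : V n}
    (hγ : HasDerivAt γ X t) (hp : γ t = p) :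
    HasDerivAt (fun s => f (γ s)) (∑ k, pd k f p * X k) t := by
  subst hp
  rw [← fderiv_eq_sum_pd]
  exact hf.hasFDerivAt.comp_hasDerivAt t hγ

end PartialDerivatives

/-! ### Smoothness of the inverse matrix. -/

section Smoothness

variable {n m : ℕ} {E : Type*} [NormedAddCommGroup E] [NormedSpace ℝ E] {s : Set E}
  {M : E → Matrix (Fin m) (Fin m) ℝ}

theorem contDiffOn_det (hM : ∀ i j, ContDiffOn ℝ ∞ (fun q => M q i j) s) :
    ContDiffOn ℝ ∞ (fun q => (M q).det) s := by
  simp only [Matrix.det_apply']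
  refine ContDiffOn.sum fun σ _ => contDiffOn_const.mul ?_
  exact contDiffOn_prod fun i _ => hM _ _

theorem contDiffOn_inv_entry (hM : ∀ i j, ContDiffOn ℝ ∞ (fun q => M q i j) s)
    (h0 : ∀ q ∈ s, (M q).det ≠ 0) (i j : Fin m) :
    ContDiffOn ℝ ∞ (fun q => (M q)⁻¹ i j) s := by
  -- Cramer's rule: an entry of the inverse is the determinant of a matrix with one row replaced by
  -- a basis vector, divided by the full determinant.
  simp only [Matrix.inv_def, Matrix.smul_apply, Ring.inverse_eq_inv', smul_eq_mul,
    Matrix.adjugate_apply]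
  refine ((contDiffOn_det hM).inv h0).mul (contDiffOn_det fun a b => ?_)
  simp only [Matrix.updateRow_apply]
  split_ifs
  · exact contDiffOn_const
  · exact hM a b

end Smoothness

/-! ### The metric, its inverse and the Christoffel symbols. -/

namespace IsMetric

variable {n : ℕ} {U : Set (V n)} {G : V n → Matrix (Fin n) (Fin n) ℝ} {p : V n}

theorem contDiffOn_inv (hG : IsMetric U G) (i j : Fin n) :
    ContDiffOn ℝ ∞ (fun q => (G q)⁻¹ i j) U :=
  contDiffOn_inv_entry hG.smooth hG.nondeg i j

theorem mul_inv (hG : IsMetric U G) (hp : p ∈ U) : G p * (G p)⁻¹ = 1 :=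
  Matrix.mul_nonsing_inv _ (hG.nondeg p hp).isUnit

theorem inv_mul (hG : IsMetric U G) (hp : p ∈ U) : (G p)⁻¹ * G p = 1 :=
  Matrix.nonsing_inv_mul _ (hG.nondeg p hp).isUnit

theorem transpose_eq (hG : IsMetric U G) (hp : p ∈ U) : (G p)ᵀ = G p := by
  ext i j; exact hG.symm p hp j i

theorem inv_symm (hG : IsMetric U G) (hp : p ∈ U) (i j : Fin n) :
    (G p)⁻¹ i j = (G p)⁻¹ j i := by
  have h := Matrix.transpose_nonsing_inv (G p)
  rw [hG.transpose_eq hp] at h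
  exact congrFun (congrFun h j) i

theorem sum_inv_metric (hG : IsMetric U G) (hp : p ∈ U) (t : V n) (a : Fin n) :
    ∑ i, (G p)⁻¹ a i * ∑ m, G p i m * t m = t a := by
  have h : (G p)⁻¹ *ᵥ (G p *ᵥ t) = t := by
    rw [Matrix.mulVec_mulVec, hG.inv_mul hp, Matrix.one_mulVec]
  exact congrFun h a

theorem sum_metric_mul_inv (hG : IsMetric U G) (hp : p ∈ U) (i j : Fin n) :
    ∑ m, G p i m * (G p)⁻¹ m j = (1 : Matrix (Fin n) (Fin n) ℝ) i j := by
  rw [← Matrix.mul_apply, hG.mul_inv hp]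

theorem pd_inv_symm (hU : IsOpen U) (hG : IsMetric U G) (hp : p ∈ U) (k i j : Fin n) :
    pd k (fun q => (G q)⁻¹ i j) p = pd k (fun q => (G q)⁻¹ j i) p :=
  pd_congr hU hp fun _ hq => hG.inv_symm hq i j

theorem christoffel_symm (hU : IsOpen U) (hG : IsMetric U G) (hp : p ∈ U) (j s k : Fin n) :
    christoffel G p j s k = christoffel G p j k s := by
  simp only [christoffel]
  congr 1
  refine Finset.sum_congr rfl fun m _ => ?_
  rw [hG.pd_inv_symm hU hp m s k]; ring

theorem contDiffOn_christoffel (hU : IsOpen U) (hG : IsMetric U G) (j s k : Fin n) :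
    ContDiffOn ℝ ∞ (fun q => christoffel G q j s k) U := by
  have h1 := hG.smooth
  have h2 : ∀ i a b, ContDiffOn ℝ ∞ (fun q => pd i (fun r => (G r)⁻¹ a b) q) U :=
    fun i a b => contDiffOn_pd hU (hG.contDiffOn_inv a b) i
  simp only [christoffel]
  fun_prop

theorem lower_christoffel (hG : IsMetric U G) (hp : p ∈ U) (a s k : Fin n) :
    ∑ i, (G p)⁻¹ a i * christoffel G p i s k = (1 / 2) *
      (pd s (fun q => (G q)⁻¹ a k) p + pd k (fun q => (G q)⁻¹ a s) p
        - pd a (fun q => (G q)⁻¹ s k) p) := by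
  rw [← hG.sum_inv_metric hp (fun m => (1 / 2) * (pd s (fun q => (G q)⁻¹ m k) p
    + pd k (fun q => (G q)⁻¹ m s) p - pd m (fun q => (G q)⁻¹ s k) p)) a]
  refine Finset.sum_congr rfl fun i _ => ?_
  rw [christoffel, Finset.mul_sum]
  congr 1
  exact Finset.sum_congr rfl fun m _ => by ring

/-- Metric compatibility for the covariant components: in the sum of the two Christoffel symbols of
the first kind, all derivatives but `∂_k g_{ij}` cancel. -/
theorem pd_inv_metric (hU : IsOpen U) (hG : IsMetric U G) (hp : p ∈ U) (k i j : Fin n) :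
    pd k (fun q => (G q)⁻¹ i j) p =
      ∑ m, (G p)⁻¹ i m * christoffel G p m k j + ∑ m, (G p)⁻¹ j m * christoffel G p m k i := by
  rw [hG.lower_christoffel hp, hG.lower_christoffel hp, hG.pd_inv_symm hU hp k j i,
    hG.pd_inv_symm hU hp i k j, hG.pd_inv_symm hU hp j k i]
  ring

/-- Metric compatibility for the contravariant components, obtained from `pd_inv_metric` by
differentiating `g g⁻¹ = 1`: with `D`, `D'` the derivatives of `g` and `g⁻¹` one has `D = -g D' g`.
-/
theorem pd_metric (hU : IsOpen U) (hG : IsMetric U G) (hp : p ∈ U) (k i j : Fin n) :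
    pd k (fun q => G q i j) p =
      - ∑ m, (christoffel G p i k m * G p m j + christoffel G p j k m * G p i m) := by
  have hd : ∀ a b, DifferentiableAt ℝ (fun q => G q a b) p :=
    fun a b => contDiffOn_differentiableAt hU (hG.smooth a b) hp
  have hd' : ∀ a b, DifferentiableAt ℝ (fun q => (G q)⁻¹ a b) p :=
    fun a b => contDiffOn_differentiableAt hU (hG.contDiffOn_inv a b) hp
  let D : Matrix (Fin n) (Fin n) ℝ := Matrix.of fun a b => pd k (fun q => G q a b) p
  let D' : Matrix (Fin n) (Fin n) ℝ := Matrix.of fun a b => pd k (fun q => (G q)⁻¹ a b) p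
  let C : Matrix (Fin n) (Fin n) ℝ := Matrix.of fun a b => christoffel G p a k b
  have h1 : D * (G p)⁻¹ + G p * D' = 0 := by
    ext a b
    have h := pd_congr (k := k) hU hp (f := fun q => ∑ m, G q a m * (G q)⁻¹ m b)
      (g := fun _ => (1 : Matrix (Fin n) (Fin n) ℝ) a b)
      fun q hq => hG.sum_metric_mul_inv hq a b
    rw [pd_const, pd_sum _ (fun m _ => (hd a m).fun_mul (hd' m b))] at h
    simp only [pd_mul (hd _ _) (hd' _ _), Finset.sum_add_distrib] at h
    simpa [Matrix.mul_apply, D, D'] using h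
  have h2 : D' = (G p)⁻¹ * C + ((G p)⁻¹ * C)ᵀ := by
    ext a b
    simp [D', C, Matrix.mul_apply, hG.pd_inv_metric hU hp k a b]
    exact Finset.sum_congr rfl fun _ _ => mul_comm _ _
  have h3 : D = -(C * G p + (C * G p)ᵀ) := by
    have h4 : D * (G p)⁻¹ * G p = - (G p * D') * G p := by rw [eq_neg_of_add_eq_zero_left h1]
    rw [Matrix.mul_assoc, hG.inv_mul hp, Matrix.mul_one] at h4
    have h5 : ((G p)⁻¹)ᵀ = (G p)⁻¹ := by ext a b; exact hG.inv_symm hp b a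
    rw [h4, h2, Matrix.neg_mul, Matrix.mul_add, Matrix.add_mul, ← Matrix.mul_assoc, hG.mul_inv hp,
      Matrix.one_mul, Matrix.transpose_mul, Matrix.transpose_mul, hG.transpose_eq hp, h5]
    simp only [Matrix.mul_assoc, hG.inv_mul hp, Matrix.mul_one]
  have h6 := congrFun (congrFun h3 i) j
  simp only [D, C, Matrix.neg_apply, Matrix.add_apply, Matrix.transpose_apply, Matrix.mul_apply,
    Matrix.of_apply] at h6
  rw [h6, ← Finset.sum_add_distrib]
  congr 1
  refine Finset.sum_congr rfl fun m _ => ?_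
  rw [hG.symm p hp m i]

end IsMetric

/-! ### Covariant Hessians, gradients and the Ricci identity. -/

section CovariantDerivatives

variable {n : ℕ} {U : Set (V n)} {G : V n → Matrix (Fin n) (Fin n) ℝ} {p : V n}

/-- The covariant Hessian `∇_s ∇_j f`. -/
def hessCov (G : V n → Matrix (Fin n) (Fin n) ℝ) (f : V n → ℝ) (p : V n) (s j : Fin n) : ℝ :=
  pd s (fun q => pd j f q) p - ∑ k, christoffel G p k s j * pd k f p

/-- The contravariant components of a covector. -/
def raise (G : V n → Matrix (Fin n) (Fin n) ℝ) (p θ : V n) (i : Fin n) : ℝ :=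
  ∑ m, G p i m * θ m

/-- The differential of a function. -/
def grad (f : V n → ℝ) (p : V n) : V n := fun k => pd k f p

theorem hess_apply (f : V n → ℝ) (i j : Fin n) :
    hess G f p i j = ∑ s, G p i s * hessCov G f p s j := rfl

theorem sum_one_mul (i : Fin n) (f : V n) :
    ∑ m, (1 : Matrix (Fin n) (Fin n) ℝ) i m * f m = f i := by
  simp [Matrix.one_apply]

theorem sum_mul_one (i : Fin n) (f : V n) :
    ∑ m, f m * (1 : Matrix (Fin n) (Fin n) ℝ) m i = f i := by
  simp [Matrix.one_apply]

theorem one_symm (i j : Fin n) :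
    (1 : Matrix (Fin n) (Fin n) ℝ) i j = (1 : Matrix (Fin n) (Fin n) ℝ) j i := by
  simp [Matrix.one_apply, eq_comm]

theorem hessCov_symm (hU : IsOpen U) (hG : IsMetric U G) {f : V n → ℝ} (hf : ContDiffOn ℝ ∞ f U)
    (hp : p ∈ U) (s j : Fin n) : hessCov G f p s j = hessCov G f p j s := by
  simp only [hessCov, pd_comm hU hf hp s j, hG.christoffel_symm hU hp _ s j]

theorem contDiffOn_hessCov (hU : IsOpen U) (hG : IsMetric U G) {f : V n → ℝ}
    (hf : ContDiffOn ℝ ∞ f U) (s j : Fin n) :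
    ContDiffOn ℝ ∞ (fun q => hessCov G f q s j) U := by
  have h1 := fun k => contDiffOn_pd hU hf k
  have h2 := fun k => contDiffOn_pd hU (h1 j) k
  have h3 := hG.contDiffOn_christoffel hU
  simp only [hessCov]
  fun_prop

theorem contDiffOn_hess (hU : IsOpen U) (hG : IsMetric U G) {f : V n → ℝ}
    (hf : ContDiffOn ℝ ∞ f U) (i j : Fin n) :
    ContDiffOn ℝ ∞ (fun q => hess G f q i j) U := by
  have h1 := contDiffOn_hessCov hU hG hf
  have h2 := hG.smooth
  simp only [hess_apply]
  fun_prop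

theorem sum_inv_raise (hG : IsMetric U G) (hp : p ∈ U) (θ : V n) (a : Fin n) :
    ∑ m, (G p)⁻¹ a m * raise G p θ m = θ a :=
  hG.sum_inv_metric hp θ a

theorem sum_mul_raise_comm (hG : IsMetric U G) (hp : p ∈ U) (θ τ : V n) :
    ∑ m, θ m * raise G p τ m = ∑ m, τ m * raise G p θ m := by
  simp only [raise, Finset.mul_sum]
  rw [Finset.sum_comm]
  refine Finset.sum_congr rfl fun a _ => Finset.sum_congr rfl fun b _ => ?_
  rw [hG.symm p hp a b]; ring

/-- Raising an index commutes with the covariant derivative, so `∂_k θ^i` is the raised `∇_k θ`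
minus the Christoffel term of the vector. -/
theorem pd_raise (hU : IsOpen U) (hG : IsMetric U G) (hp : p ∈ U) {θ : V n → V n}
    (hθ : ∀ m, DifferentiableAt ℝ (fun q => θ q m) p) (k i : Fin n) :
    pd k (fun q => raise G q (θ q) i) p =
      ∑ m, G p i m * (pd k (fun q => θ q m) p - ∑ r, christoffel G p r k m * θ p r)
        - ∑ r, christoffel G p i k r * raise G p (θ p) r := by
  have hd : ∀ a b, DifferentiableAt ℝ (fun q => G q a b) p :=
    fun a b => contDiffOn_differentiableAt hU (hG.smooth a b) hp
  simp only [raise]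
  rw [pd_sum _ fun m _ => (hd i m).fun_mul (hθ m)]
  simp only [pd_mul (hd _ _) (hθ _), hG.pd_metric hU hp, mul_sub, Finset.sum_sub_distrib,
    Finset.sum_add_distrib, neg_mul, Finset.sum_mul, Finset.mul_sum, add_mul,
    Finset.sum_neg_distrib, neg_add]
  have e1 : ∑ m, ∑ r, christoffel G p i k r * G p r m * θ p m =
      ∑ r, ∑ m, christoffel G p i k r * (G p r m * θ p m) := by
    rw [Finset.sum_comm]
    exact Finset.sum_congr rfl fun _ _ => Finset.sum_congr rfl fun _ _ => by ring
  have e2 : ∑ m, ∑ r, christoffel G p m k r * G p i r * θ p m =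
      ∑ r, ∑ m, G p i r * (christoffel G p m k r * θ p m) := by
    rw [Finset.sum_comm]
    exact Finset.sum_congr rfl fun _ _ => Finset.sum_congr rfl fun _ _ => by ring
  rw [e1, e2]; ring

theorem pd_grad (f : V n → ℝ) (k m : Fin n) :
    pd k (fun q => pd m f q) p =
      hessCov G f p k m + ∑ r, christoffel G p r k m * pd r f p := by
  rw [hessCov]; ring

/-- The scalar product of the differentials of two functions. -/
def gradInner (G : V n → Matrix (Fin n) (Fin n) ℝ) (f g : V n → ℝ) (p : V n) : ℝ :=
  ∑ i, pd i f p * raise G p (grad g p) i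

theorem gradSq_eq (f : V n → ℝ) : gradSq G f p = gradInner G f f p := by
  simp only [gradSq, gradInner, raise, Finset.mul_sum, grad]
  exact Finset.sum_congr rfl fun _ _ => Finset.sum_congr rfl fun _ _ => by ring

theorem contDiffOn_raise_grad (hU : IsOpen U) (hG : IsMetric U G) {f : V n → ℝ}
    (hf : ContDiffOn ℝ ∞ f U) (i : Fin n) :
    ContDiffOn ℝ ∞ (fun q => raise G q (grad f q) i) U := by
  have h1 := fun k => contDiffOn_pd hU hf k
  have h2 := hG.smooth
  simp only [raise, grad]
  fun_prop

theorem contDiffOn_gradInner (hU : IsOpen U) (hG : IsMetric U G) {f g : V n → ℝ}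
    (hf : ContDiffOn ℝ ∞ f U) (hg : ContDiffOn ℝ ∞ g U) :
    ContDiffOn ℝ ∞ (gradInner G f g) U := by
  have h1 := fun k => contDiffOn_pd hU hf k
  have h2 := contDiffOn_raise_grad hU hG hg
  unfold gradInner
  fun_prop

/-- By metric compatibility the product rule holds with covariant derivatives, and the Christoffel
terms of the two factors cancel. -/
theorem pd_gradInner (hU : IsOpen U) (hG : IsMetric U G) (hp : p ∈ U) {f g : V n → ℝ}
    (hf : ContDiffOn ℝ ∞ f U) (hg : ContDiffOn ℝ ∞ g U) (k : Fin n) :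
    pd k (gradInner G f g) p =
      ∑ m, hess G f p m k * pd m g p + ∑ m, hess G g p m k * pd m f p := by
  have hdf : ∀ m, DifferentiableAt ℝ (fun q => pd m f q) p :=
    fun m => contDiffOn_differentiableAt hU (contDiffOn_pd hU hf m) hp
  have hdg : ∀ m, DifferentiableAt ℝ (fun q => grad g q m) p :=
    fun m => contDiffOn_differentiableAt hU (contDiffOn_pd hU hg m) hp
  have hdr : ∀ i, DifferentiableAt ℝ (fun q => raise G q (grad g q) i) p :=
    fun i => contDiffOn_differentiableAt hU (contDiffOn_raise_grad hU hG hg i) hp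
  have e : gradInner G f g = fun q => ∑ i, pd i f q * raise G q (grad g q) i := rfl
  rw [e, pd_sum _ fun i _ => (hdf i).fun_mul (hdr i)]
  simp only [pd_mul (hdf _) (hdr _), pd_raise hU hG hp hdg]
  have e1 : ∀ i, ∑ m, G p i m * (pd k (fun q => grad g q m) p
      - ∑ r, christoffel G p r k m * grad g p r) = hess G g p i k := by
    intro i
    rw [hess_apply]
    refine Finset.sum_congr rfl fun m _ => ?_
    rw [hessCov_symm hU hG hg hp]
    rfl
  have e2 : ∑ i, hessCov G f p k i * raise G p (grad g p) i = ∑ m, hess G f p m k * pd m g p := by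
    simp only [raise, hess_apply, Finset.mul_sum, Finset.sum_mul, grad]
    rw [Finset.sum_comm]
    refine Finset.sum_congr rfl fun a _ => Finset.sum_congr rfl fun b _ => ?_
    rw [hG.symm p hp a b, hessCov_symm hU hG hf hp k b]; ring
  have e3 : ∑ i, (∑ r, christoffel G p r k i * pd r f p) * raise G p (grad g p) i =
      ∑ i, pd i f p * ∑ r, christoffel G p i k r * raise G p (grad g p) r := by
    simp only [Finset.mul_sum, Finset.sum_mul]
    rw [Finset.sum_comm]
    exact Finset.sum_congr rfl fun _ _ => Finset.sum_congr rfl fun _ _ => by ring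
  simp only [e1]
  simp only [pd_grad (G := G) f, add_mul, mul_sub, Finset.sum_add_distrib,
    Finset.sum_sub_distrib, e2, e3]
  have e4 : ∑ i, pd i f p * hess G g p i k = ∑ i, hess G g p i k * pd i f p :=
    Finset.sum_congr rfl fun _ _ => mul_comm _ _
  rw [e4]; ring

/-- The commutator of covariant derivatives, applied to the differential of a function. -/
theorem hessCov_codazzi (hU : IsOpen U) (hG : IsMetric U G) (hp : p ∈ U) {f : V n → ℝ}
    (hf : ContDiffOn ℝ ∞ f U) (k j s : Fin n) :
    (pd k (fun q => hessCov G f q s j) p - ∑ m, christoffel G p m k s * hessCov G f p m j)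
      - (pd j (fun q => hessCov G f q s k) p - ∑ m, christoffel G p m j s * hessCov G f p m k)
      = - ∑ m, riemann G p m s k j * pd m f p := by
  have hc : ∀ a b c, DifferentiableAt ℝ (fun q => christoffel G q a b c) p :=
    fun a b c => contDiffOn_differentiableAt hU (hG.contDiffOn_christoffel hU a b c) hp
  have hf1 : ∀ m, ContDiffOn ℝ ∞ (fun q => pd m f q) U := fun m => contDiffOn_pd hU hf m
  have hd1 : ∀ m, DifferentiableAt ℝ (fun q => pd m f q) p :=
    fun m => contDiffOn_differentiableAt hU (hf1 m) hp
  have hd2 : ∀ s m, DifferentiableAt ℝ (fun q => pd s (fun r => pd m f r) q) p :=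
    fun s m => contDiffOn_differentiableAt hU (contDiffOn_pd hU (hf1 m) s) hp
  have key : ∀ k j, pd k (fun q => hessCov G f q s j) p =
      pd k (fun q => pd s (fun r => pd j f r) q) p
      - ∑ m, (pd k (fun q => christoffel G q m s j) p * pd m f p
        + christoffel G p m s j * (hessCov G f p m k + ∑ r, christoffel G p r k m * pd r f p)) := by
    intro k j
    simp only [hessCov]
    rw [pd_sub (hd2 s j) (.fun_sum fun m _ => (hc m s j).fun_mul (hd1 m)),
      pd_sum _ fun m _ => (hc m s j).fun_mul (hd1 m)]
    simp only [pd_mul (hc _ _ _) (hd1 _)]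
    congr 1
    refine Finset.sum_congr rfl fun m _ => ?_
    rw [pd_grad (G := G), hessCov_symm hU hG hf hp k m, hessCov]
  -- Third partial derivatives are symmetric in `k` and `j`, so they drop out of the difference.
  -- What remains multiplying `∂_m f` is derivatives and products of Christoffel symbols, that is,
  -- curvature.
  have third : pd k (fun q => pd s (fun r => pd j f r) q) p =
      pd j (fun q => pd s (fun r => pd k f r) q) p := by
    rw [pd_comm hU (hf1 j) hp k s, pd_comm hU (hf1 k) hp j s]
    exact pd_congr hU hp fun q hq => pd_comm hU hf hq k j
  have swap : ∀ k j, ∑ m, christoffel G p m s j * ∑ r, christoffel G p r k m * pd r f p =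
      ∑ m, (∑ r, christoffel G p m k r * christoffel G p r j s) * pd m f p := by
    intro k j
    simp only [Finset.mul_sum, Finset.sum_mul]
    rw [Finset.sum_comm]
    refine Finset.sum_congr rfl fun _ _ => Finset.sum_congr rfl fun r _ => ?_
    rw [hG.christoffel_symm hU hp r s j]; ring
  have sw : ∀ k j, ∑ m, christoffel G p m s j * hessCov G f p m k =
      ∑ m, christoffel G p m j s * hessCov G f p m k := by
    intro k j
    refine Finset.sum_congr rfl fun m _ => ?_
    rw [hG.christoffel_symm hU hp m s j]
  have pdc : ∀ m k j, pd k (fun q => christoffel G q m s j) p =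
      pd k (fun q => christoffel G q m j s) p :=
    fun m k j => pd_congr hU hp fun q hq => hG.christoffel_symm hU hq m s j
  rw [key, key, third]
  simp only [riemann, mul_add, add_mul, sub_mul, Finset.sum_add_distrib, Finset.sum_sub_distrib,
    swap, sw, pdc]
  ring

end CovariantDerivatives

/-! ### The conformal change of the metric and the affinor of the tail. -/

section Conformal

variable {n : ℕ} {U : Set (V n)} {G : V n → Matrix (Fin n) (Fin n) ℝ} {B : V n → ℝ} {p : V n}

theorem IsMetric.smul {c : V n → ℝ} (hG : IsMetric U G) (hc : ContDiffOn ℝ ∞ c U)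
    (hc0 : ∀ p ∈ U, c p ≠ 0) : IsMetric U (fun p => c p • G p) where
  smooth i j := hc.mul (hG.smooth i j)
  symm p hp i j := by simp [hG.symm p hp i j]
  nondeg p hp := by simp [hG.nondeg p hp, hc0 p hp]

theorem isMetric_newMetric (hG : IsMetric U G) (hB : ContDiffOn ℝ ∞ B U)
    (hB0 : ∀ p ∈ U, B p ≠ 0) : IsMetric U (newMetric G B) :=
  hG.smul (hB.pow 2) fun p hp => pow_ne_zero 2 (hB0 p hp)

theorem newMetric_inv (hG : IsMetric U G) (hp : p ∈ U) (hB0 : B p ≠ 0) (i j : Fin n) :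
    (newMetric G B p)⁻¹ i j = (G p)⁻¹ i j / B p ^ 2 := by
  have : (newMetric G B p)⁻¹ = (B p ^ 2)⁻¹ • (G p)⁻¹ := by
    apply Matrix.inv_eq_right_inv
    rw [newMetric, Matrix.smul_mul, Matrix.mul_smul, smul_smul, hG.mul_inv hp,
      mul_inv_cancel₀ (pow_ne_zero 2 hB0), one_smul]
  rw [this, Matrix.smul_apply, smul_eq_mul]; ring

/-- The difference `Γ^j_{sk} - Γ̃^j_{sk}` of the Christoffel symbols of `G` and of `B² G`. -/
def conformalDiff (G : V n → Matrix (Fin n) (Fin n) ℝ) (B : V n → ℝ) (p : V n)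
    (j s k : Fin n) : ℝ :=
  ((1 : Matrix (Fin n) (Fin n) ℝ) j k * pd s B p + (1 : Matrix (Fin n) (Fin n) ℝ) j s * pd k B p
    - raise G p (grad B p) j * (G p)⁻¹ s k) / B p

/-- The covariant metric becomes `g_{ij} / B²`. Each of the three derivatives in the Christoffel
symbol acquires a term `-2 g_{ij} ∂B / B³`; contracted with `B² g^{jm}` these give the two identity
terms and the gradient term of `conformalDiff`. -/
theorem christoffel_newMetric (hU : IsOpen U) (hG : IsMetric U G) (hB : ContDiffOn ℝ ∞ B U)
    (hB0 : ∀ p ∈ U, B p ≠ 0) (hp : p ∈ U) (j s k : Fin n) :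
    christoffel (newMetric G B) p j s k = christoffel G p j s k - conformalDiff G B p j s k := by
  have h0 := hB0 p hp
  have hdB := contDiffOn_differentiableAt hU hB hp
  have hd : ∀ a b, DifferentiableAt ℝ (fun q => (G q)⁻¹ a b) p :=
    fun a b => contDiffOn_differentiableAt hU (hG.contDiffOn_inv a b) hp
  have key : ∀ a b c, pd a (fun q => (newMetric G B q)⁻¹ b c) p =
      pd a (fun q => (G q)⁻¹ b c) p / B p ^ 2 - 2 * (G p)⁻¹ b c * pd a B p / B p ^ 3 := by
    intro a b c
    rw [pd_congr hU hp fun q hq => newMetric_inv hG hq (hB0 q hq) b c,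
      pd_div (hd b c) (hdB.fun_pow 2) (pow_ne_zero 2 h0)]
    simp only [pow_two]
    rw [pd_mul hdB hdB]
    field_simp
    ring
  have e : ∀ m, newMetric G B p j m * (pd s (fun q => (newMetric G B q)⁻¹ m k) p
      + pd k (fun q => (newMetric G B q)⁻¹ m s) p - pd m (fun q => (newMetric G B q)⁻¹ s k) p) =
      G p j m * (pd s (fun q => (G q)⁻¹ m k) p + pd k (fun q => (G q)⁻¹ m s) p
        - pd m (fun q => (G q)⁻¹ s k) p)
      - 2 / B p * (pd s B p * (G p j m * (G p)⁻¹ m k) + pd k B p * (G p j m * (G p)⁻¹ m s)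
        - (G p)⁻¹ s k * (G p j m * grad B p m)) := by
    intro m
    simp only [key]
    simp only [newMetric, Matrix.smul_apply, smul_eq_mul, grad]
    field_simp
    ring
  simp only [christoffel, e, Finset.sum_sub_distrib, Finset.sum_add_distrib, ← Finset.mul_sum,
    hG.sum_metric_mul_inv hp, conformalDiff, raise]
  ring

/-- The behaviour of the Hessian under `G ↦ B² G`. -/
theorem hess_newMetric (hU : IsOpen U) (hG : IsMetric U G) (hB : ContDiffOn ℝ ∞ B U)
    (hB0 : ∀ p ∈ U, B p ≠ 0) (hp : p ∈ U) (f : V n → ℝ) (i j : Fin n) :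
    hess (newMetric G B) f p i j = B p ^ 2 * hess G f p i j
      + B p * (raise G p (grad B p) i * pd j f p + raise G p (grad f p) i * pd j B p
        - (1 : Matrix (Fin n) (Fin n) ℝ) i j * gradInner G B f p) := by
  have h0 := hB0 p hp
  have e : ∀ s, hessCov (newMetric G B) f p s j = hessCov G f p s j
      + (pd s B p * pd j f p + pd s f p * pd j B p - (G p)⁻¹ s j * gradInner G B f p) / B p := by
    intro s
    have e1 : ∑ k, conformalDiff G B p k s j * pd k f p =
        (pd s B p * pd j f p + pd s f p * pd j B p - (G p)⁻¹ s j * gradInner G B f p) / B p := by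
      have e2 : ∀ k, conformalDiff G B p k s j * pd k f p =
          (pd s B p * (pd k f p * (1 : Matrix (Fin n) (Fin n) ℝ) k j)
          + pd j B p * (pd k f p * (1 : Matrix (Fin n) (Fin n) ℝ) k s)
          - (G p)⁻¹ s j * (grad f p k * raise G p (grad B p) k)) / B p := by
        intro k; simp only [conformalDiff, grad]; ring
      simp only [e2, ← Finset.sum_div, Finset.sum_add_distrib, Finset.sum_sub_distrib,
        ← Finset.mul_sum, sum_mul_one, sum_mul_raise_comm hG hp (grad f p) (grad B p), gradInner]
      simp only [grad]; ring
    simp only [hessCov, christoffel_newMetric hU hG hB hB0 hp, sub_mul, Finset.sum_sub_distrib, e1]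
    ring
  have e3 : ∀ s, newMetric G B p i s * hessCov (newMetric G B) f p s j =
      B p ^ 2 * (G p i s * hessCov G f p s j) + B p * (pd j f p * (G p i s * grad B p s)
        + pd j B p * (G p i s * grad f p s) - gradInner G B f p * (G p i s * (G p)⁻¹ s j)) := by
    intro s
    rw [e]
    simp only [newMetric, Matrix.smul_apply, smul_eq_mul, grad]
    field_simp
  simp only [hess_apply, e3, Finset.sum_add_distrib, Finset.sum_sub_distrib, ← Finset.mul_sum,
    hG.sum_metric_mul_inv hp, raise]
  ring

theorem contDiffOn_newTail (hU : IsOpen U) (hG : IsMetric U G) (hB : ContDiffOn ℝ ∞ B U)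
    (i j : Fin n) : ContDiffOn ℝ ∞ (fun q => newTail G B q i j) U := by
  have h1 := contDiffOn_hess hU hG hB i j
  have h2 := contDiffOn_gradInner hU hG hB hB
  simp only [newTail, Matrix.sub_apply, Matrix.smul_apply, smul_eq_mul, gradSq_eq]
  fun_prop

theorem newTail_apply (i j : Fin n) : newTail G B p i j =
    B p * hess G B p i j
      - (1 / 2) * gradInner G B B p * (1 : Matrix (Fin n) (Fin n) ℝ) i j := by
  simp [newTail, gradSq_eq]

theorem sum_inv_hess (hG : IsMetric U G) (hp : p ∈ U) (f : V n → ℝ) (i j : Fin n) :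
    ∑ m, (G p)⁻¹ i m * hess G f p m j = hessCov G f p i j :=
  hG.sum_inv_metric hp (fun s => hessCov G f p s j) i

/-- With its index lowered the affinor is `(B ∇_i ∇_j B - ½ (∇B)² g_{ij}) / B²`, a combination of
symmetric tensors. -/
theorem newMetric_inv_mul_newTail_isSymm (hU : IsOpen U) (hG : IsMetric U G)
    (hB : ContDiffOn ℝ ∞ B U) (hB0 : ∀ p ∈ U, B p ≠ 0) (hp : p ∈ U) :
    ((newMetric G B p)⁻¹ * newTail G B p).IsSymm := by
  have e : ∀ i j, ((newMetric G B p)⁻¹ * newTail G B p) i j =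
      (B p * hessCov G B p i j - (1 / 2) * gradInner G B B p * (G p)⁻¹ i j) / B p ^ 2 := by
    intro i j
    have e1 : ∀ m, (newMetric G B p)⁻¹ i m * newTail G B p m j =
        (B p * ((G p)⁻¹ i m * hess G B p m j) - (1 / 2) * gradInner G B B p *
          ((G p)⁻¹ i m * (1 : Matrix (Fin n) (Fin n) ℝ) m j)) / B p ^ 2 := by
      intro m
      rw [newMetric_inv hG hp (hB0 p hp), newTail_apply]; ring
    simp only [Matrix.mul_apply, e1, ← Finset.sum_div, Finset.sum_sub_distrib, ← Finset.mul_sum,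
      sum_inv_hess hG hp]
    rw [sum_mul_one j (fun m => (G p)⁻¹ i m)]
  ext i j
  rw [Matrix.transpose_apply, e, e, hessCov_symm hU hG hB hp i j, hG.inv_symm hp i j]

/-- Differentiating `B ∇^i ∇_j B - ½ (∇B)² δ^i_j` gives `B` times a third covariant derivative,
symmetric in `j` and `k` because `g` is flat, and two further terms. The conformal correction
cancels `∂_k B ∇^i ∇_j B` and symmetrizes the term with `δ^i_j`, so that the sum is symmetric. -/
theorem covDeriv_newTail (hU : IsOpen U) (hG : IsMetric U G) (hflat : IsFlat U G)
    (hB : ContDiffOn ℝ ∞ B U) (hB0 : ∀ p ∈ U, B p ≠ 0) (hp : p ∈ U) (i j k : Fin n) :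
    covDeriv (newMetric G B) (newTail G B) p k i j =
      covDeriv (newMetric G B) (newTail G B) p j i k := by
  have h0 := hB0 p hp
  have hdB := contDiffOn_differentiableAt hU hB hp
  have hdN : ∀ i j, DifferentiableAt ℝ (fun q => hess G B q i j) p :=
    fun i j => contDiffOn_differentiableAt hU (contDiffOn_hess hU hG hB i j) hp
  have hdH : ∀ i j, DifferentiableAt ℝ (fun q => hessCov G B q i j) p :=
    fun i j => contDiffOn_differentiableAt hU (contDiffOn_hessCov hU hG hB i j) hp
  have hdS : DifferentiableAt ℝ (gradInner G B B) p :=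
    contDiffOn_differentiableAt hU (contDiffOn_gradInner hU hG hB hB) hp
  have hN : ∀ k j, pd k (fun q => hess G B q i j) p =
      ∑ s, G p i s * (pd k (fun q => hessCov G B q s j) p
        - ∑ m, christoffel G p m k s * hessCov G B p m j)
      - ∑ m, christoffel G p i k m * hess G B p m j :=
    fun k j => pd_raise (θ := fun q s => hessCov G B q s j) hU hG hp (fun s => hdH s j) k i
  -- The place where flatness is used: the Ricci identity has no curvature term.
  have hcod : ∑ s, G p i s * (pd k (fun q => hessCov G B q s j) p
        - ∑ m, christoffel G p m k s * hessCov G B p m j) =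
      ∑ s, G p i s * (pd j (fun q => hessCov G B q s k) p
        - ∑ m, christoffel G p m j s * hessCov G B p m k) := by
    refine Finset.sum_congr rfl fun s _ => ?_
    have h := hessCov_codazzi hU hG hp hB k j s
    simp only [hflat p hp, zero_mul, Finset.sum_const_zero, neg_zero] at h
    rw [sub_eq_zero.1 h]
  have hpd : ∀ k j, pd k (fun q => newTail G B q i j) p =
      pd k B p * hess G B p i j + B p * pd k (fun q => hess G B q i j) p
      - (∑ m, hess G B p m k * pd m B p) * (1 : Matrix (Fin n) (Fin n) ℝ) i j := by
    intro k j
    have e : (fun q => newTail G B q i j) = fun q => B q * hess G B q i j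
        - (1 / 2) * (1 : Matrix (Fin n) (Fin n) ℝ) i j * gradInner G B B q := by
      funext q; rw [newTail_apply]; ring
    rw [e, pd_sub (hdB.fun_mul (hdN i j)) (hdS.const_mul _), pd_const_mul _ hdS,
      pd_mul hdB (hdN i j), pd_gradInner hU hG hp hB hB]
    ring
  -- By vanishing torsion the Christoffel term acting on the lower index of the affinor is symmetric
  -- and plays no role.
  have hsym : ∀ m, christoffel (newMetric G B) p m k j = christoffel (newMetric G B) p m j k :=
    fun m => (isMetric_newMetric hG hB hB0).christoffel_symm hU hp m k j
  have hC : ∀ k j, ∑ m, christoffel G p i k m * newTail G B p m j =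
      B p * ∑ m, christoffel G p i k m * hess G B p m j
        - (1 / 2) * gradInner G B B p * christoffel G p i k j := by
    intro k j
    have e : ∀ m, christoffel G p i k m * newTail G B p m j =
        B p * (christoffel G p i k m * hess G B p m j)
        - (1 / 2) * gradInner G B B p *
          (christoffel G p i k m * (1 : Matrix (Fin n) (Fin n) ℝ) m j) := by
      intro m; rw [newTail_apply]; ring
    simp only [e, Finset.sum_sub_distrib, ← Finset.mul_sum]
    rw [sum_mul_one j (fun m => christoffel G p i k m)]
  have hT : ∀ k j, ∑ m, conformalDiff G B p i k m * newTail G B p m j =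
      (pd k B p * newTail G B p i j
        + (1 : Matrix (Fin n) (Fin n) ℝ) i k * (B p * ∑ m, hess G B p m j * pd m B p
          - (1 / 2) * gradInner G B B p * pd j B p)
        - raise G p (grad B p) i * (B p * hessCov G B p k j
          - (1 / 2) * gradInner G B B p * (G p)⁻¹ k j)) / B p := by
    intro k j
    have e : ∀ m, conformalDiff G B p i k m * newTail G B p m j =
        (pd k B p * ((1 : Matrix (Fin n) (Fin n) ℝ) i m * newTail G B p m j)
        + (1 : Matrix (Fin n) (Fin n) ℝ) i k * (B p * (hess G B p m j * pd m B p)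
          - (1 / 2) * gradInner G B B p * (pd m B p * (1 : Matrix (Fin n) (Fin n) ℝ) m j))
        - raise G p (grad B p) i * (B p * ((G p)⁻¹ k m * hess G B p m j)
          - (1 / 2) * gradInner G B B p *
            ((G p)⁻¹ k m * (1 : Matrix (Fin n) (Fin n) ℝ) m j))) / B p := by
      intro m; rw [conformalDiff, newTail_apply]; ring
    simp only [e, ← Finset.sum_div, Finset.sum_sub_distrib, Finset.sum_add_distrib,
      ← Finset.mul_sum, sum_inv_hess hG hp]
    rw [sum_mul_one j (fun m => (G p)⁻¹ k m), sum_mul_one j (fun m => pd m B p),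
      sum_one_mul i (fun m => newTail G B p m j)]
  simp only [covDeriv, hsym, Finset.sum_sub_distrib]
  simp only [christoffel_newMetric hU hG hB hB0 hp, sub_mul, Finset.sum_sub_distrib]
  rw [hC, hC, hT, hT, hpd, hpd, hN, hN, hcod, hessCov_symm hU hG hB hp k j, hG.inv_symm hp k j,
    hG.christoffel_symm hU hp i k j, newTail_apply i j, newTail_apply i k]
  field_simp
  ring

end Conformal

/-! ### The curvature of the conformally changed metric. -/

section ConformalCurvature

variable {n : ℕ} {U : Set (V n)} {G : V n → Matrix (Fin n) (Fin n) ℝ} {B : V n → ℝ} {p : V n}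

theorem differentiableAt_div {f g : V n → ℝ} (hf : DifferentiableAt ℝ f p)
    (hg : DifferentiableAt ℝ g p) (h0 : g p ≠ 0) : DifferentiableAt ℝ (fun q => f q / g q) p := by
  simp only [div_eq_mul_inv]
  exact hf.fun_mul (hg.fun_inv h0)

/-- The behaviour of the Riemann tensor under `G ↦ B² G`. -/
theorem riemann_newMetric (hU : IsOpen U) (hG : IsMetric U G) (hB : ContDiffOn ℝ ∞ B U)
    (hB0 : ∀ p ∈ U, B p ≠ 0) (hp : p ∈ U) (i j k l : Fin n) :
    riemann (newMetric G B) p i j k l = riemann G p i j k l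
      + ((1 : Matrix (Fin n) (Fin n) ℝ) i k * hessCov G B p l j
        - (1 : Matrix (Fin n) (Fin n) ℝ) i l * hessCov G B p k j
        + (G p)⁻¹ l j * hess G B p i k - (G p)⁻¹ k j * hess G B p i l) / B p
      - gradInner G B B p * ((1 : Matrix (Fin n) (Fin n) ℝ) i k * (G p)⁻¹ l j
        - (1 : Matrix (Fin n) (Fin n) ℝ) i l * (G p)⁻¹ k j) / B p ^ 2 := by
  have h0 := hB0 p hp
  have hdB := contDiffOn_differentiableAt hU hB hp
  have hdc : ∀ a b c, DifferentiableAt ℝ (fun q => christoffel G q a b c) p :=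
    fun a b c => contDiffOn_differentiableAt hU (hG.contDiffOn_christoffel hU a b c) hp
  have hdb : ∀ m, DifferentiableAt ℝ (fun q => pd m B q) p :=
    fun m => contDiffOn_differentiableAt hU (contDiffOn_pd hU hB m) hp
  have hdr : ∀ i, DifferentiableAt ℝ (fun q => raise G q (grad B q) i) p :=
    fun i => contDiffOn_differentiableAt hU (contDiffOn_raise_grad hU hG hB i) hp
  have hdg : ∀ a b, DifferentiableAt ℝ (fun q => (G q)⁻¹ a b) p :=
    fun a b => contDiffOn_differentiableAt hU (hG.contDiffOn_inv a b) hp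
  have hraise : ∀ k, pd k (fun q => raise G q (grad B q) i) p =
      hess G B p i k - ∑ r, christoffel G p i k r * raise G p (grad B p) r := by
    intro k
    rw [pd_raise (θ := grad B) hU hG hp hdb, hess_apply]
    congr 1
    refine Finset.sum_congr rfl fun m _ => ?_
    rw [hessCov_symm hU hG hB hp]
    rfl
  have hdiff : ∀ k l, pd k (fun q => christoffel (newMetric G B) q i l j) p =
      pd k (fun q => christoffel G q i l j) p
      - ((1 : Matrix (Fin n) (Fin n) ℝ) i j * pd k (fun q => pd l B q) p
        + (1 : Matrix (Fin n) (Fin n) ℝ) i l * pd k (fun q => pd j B q) p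
        - (pd k (fun q => raise G q (grad B q) i) p * (G p)⁻¹ l j
          + raise G p (grad B p) i * pd k (fun q => (G q)⁻¹ l j) p)) / B p
      + conformalDiff G B p i l j * pd k B p / B p := by
    intro k l
    rw [pd_congr hU hp fun q hq => christoffel_newMetric hU hG hB hB0 hq i l j]
    simp only [conformalDiff]
    have d1 := (hdb l).const_mul ((1 : Matrix (Fin n) (Fin n) ℝ) i j)
    have d2 := (hdb j).const_mul ((1 : Matrix (Fin n) (Fin n) ℝ) i l)
    have d3 := (hdr i).fun_mul (hdg l j)
    rw [pd_sub (hdc i l j) (differentiableAt_div ((d1.fun_add d2).fun_sub d3) hdB h0),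
      pd_div ((d1.fun_add d2).fun_sub d3) hdB h0, pd_sub (d1.fun_add d2) d3, pd_add d1 d2,
      pd_const_mul _ (hdb l), pd_const_mul _ (hdb j), pd_mul (hdr i) (hdg l j)]
    field_simp
    ring
  have hquad : ∀ k l, ∑ m, christoffel (newMetric G B) p i k m * christoffel (newMetric G B) p m l j =
      ∑ m, christoffel G p i k m * christoffel G p m l j
      - (pd l B p * christoffel G p i k j + pd j B p * christoffel G p i k l
        - (G p)⁻¹ l j * ∑ r, christoffel G p i k r * raise G p (grad B p) r) / B p
      - (pd k B p * christoffel G p i l j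
        + (1 : Matrix (Fin n) (Fin n) ℝ) i k * ∑ r, christoffel G p r l j * pd r B p
        - raise G p (grad B p) i * ∑ m, (G p)⁻¹ k m * christoffel G p m l j) / B p
      + (pd k B p * ((1 : Matrix (Fin n) (Fin n) ℝ) i j * pd l B p
          + (1 : Matrix (Fin n) (Fin n) ℝ) i l * pd j B p
          - raise G p (grad B p) i * (G p)⁻¹ l j)
        + (1 : Matrix (Fin n) (Fin n) ℝ) i k * (2 * pd j B p * pd l B p
          - gradInner G B B p * (G p)⁻¹ l j)
        - raise G p (grad B p) i * ((G p)⁻¹ k j * pd l B p + (G p)⁻¹ k l * pd j B p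
          - pd k B p * (G p)⁻¹ l j)) / B p ^ 2 := by
    intro k l
    simp only [christoffel_newMetric hU hG hB hB0 hp]
    have e : ∀ m, (christoffel G p i k m - conformalDiff G B p i k m)
        * (christoffel G p m l j - conformalDiff G B p m l j) =
      christoffel G p i k m * christoffel G p m l j
      - (pd l B p * (christoffel G p i k m * (1 : Matrix (Fin n) (Fin n) ℝ) m j)
        + pd j B p * (christoffel G p i k m * (1 : Matrix (Fin n) (Fin n) ℝ) m l)
        - (G p)⁻¹ l j * (christoffel G p i k m * raise G p (grad B p) m)) / B p
      - (pd k B p * ((1 : Matrix (Fin n) (Fin n) ℝ) i m * christoffel G p m l j)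
        + (1 : Matrix (Fin n) (Fin n) ℝ) i k * (christoffel G p m l j * pd m B p)
        - raise G p (grad B p) i * ((G p)⁻¹ k m * christoffel G p m l j)) / B p
      + (pd k B p * (pd l B p * ((1 : Matrix (Fin n) (Fin n) ℝ) i m
              * (1 : Matrix (Fin n) (Fin n) ℝ) m j)
          + pd j B p * ((1 : Matrix (Fin n) (Fin n) ℝ) i m * (1 : Matrix (Fin n) (Fin n) ℝ) m l)
          - (G p)⁻¹ l j * ((1 : Matrix (Fin n) (Fin n) ℝ) i m * raise G p (grad B p) m))
        + (1 : Matrix (Fin n) (Fin n) ℝ) i k *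
          (pd l B p * (pd m B p * (1 : Matrix (Fin n) (Fin n) ℝ) m j)
          + pd j B p * (pd m B p * (1 : Matrix (Fin n) (Fin n) ℝ) m l)
          - (G p)⁻¹ l j * (pd m B p * raise G p (grad B p) m))
        - raise G p (grad B p) i *
          (pd l B p * ((G p)⁻¹ k m * (1 : Matrix (Fin n) (Fin n) ℝ) m j)
          + pd j B p * ((G p)⁻¹ k m * (1 : Matrix (Fin n) (Fin n) ℝ) m l)
          - (G p)⁻¹ l j * ((G p)⁻¹ k m * raise G p (grad B p) m))) / B p ^ 2 := by
      intro m
      simp only [conformalDiff]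
      field_simp
      ring
    have a1 := fun j => sum_mul_one j (fun m => christoffel G p i k m)
    have a2 := fun j => sum_mul_one j (fun m => (G p)⁻¹ k m)
    have a3 := fun j => sum_mul_one j (fun m => pd m B p)
    have a4 := fun j => sum_mul_one j (fun m => (1 : Matrix (Fin n) (Fin n) ℝ) i m)
    have a5 := sum_one_mul i (fun m => christoffel G p m l j)
    have a6 := sum_one_mul i (fun m => raise G p (grad B p) m)
    simp only [e, Finset.sum_add_distrib, Finset.sum_sub_distrib, ← Finset.sum_div,
      ← Finset.mul_sum]
    rw [a1, a1, a2, a2, a3, a3, a4, a4, a5, a6, sum_inv_raise hG hp]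
    simp only [gradInner, grad]
    ring
  have hlow : ∀ k l, ∑ m, (G p)⁻¹ k m * christoffel G p m l j =
      ∑ m, (G p)⁻¹ k m * christoffel G p m j l := fun k l =>
    Finset.sum_congr rfl fun m _ => by rw [hG.christoffel_symm hU hp m l j]
  have hpg := fun k l => pd_grad (G := G) (p := p) B k l
  simp only [riemann, Finset.sum_sub_distrib, hquad, hdiff, hraise]
  -- Partial derivatives of `∂B` and of the covariant metric are replaced by covariant Hessians and
  -- Christoffel symbols. The Christoffel symbols that appear cancel against those of the quadratic
  -- terms, leaving a tensor.
  rw [hpg k j, hpg l j, pd_comm hU hB hp k l, hG.pd_inv_metric hU hp, hG.pd_inv_metric hU hp,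
    hG.christoffel_symm hU hp i l k, hG.inv_symm hp l k, hlow k l, hlow l k, conformalDiff,
    conformalDiff]
  simp only [fun m => hG.christoffel_symm hU hp m l k]
  field_simp
  ring

/-- Only the conformal terms of `riemann_newMetric` survive flatness. Contraction with `B² g^{jm}`
multiplies the Hessian terms by `B` and leaves `-(∇B)²` times the constant-curvature tensor; half of
it goes to each of the affinors `w^i_k` and `w^j_l`, which accounts for the factor `½` in the
affinor. -/
theorem curvature_newMetric (hU : IsOpen U) (hG : IsMetric U G) (hflat : IsFlat U G)
    (hB : ContDiffOn ℝ ∞ B U) (hB0 : ∀ p ∈ U, B p ≠ 0) (hp : p ∈ U) (i j k l : Fin n) :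
    curvature (newMetric G B) p i j k l =
      newTail G B p i k * (1 : Matrix (Fin n) (Fin n) ℝ) j l
      + newTail G B p j l * (1 : Matrix (Fin n) (Fin n) ℝ) i k
      - newTail G B p j k * (1 : Matrix (Fin n) (Fin n) ℝ) i l
      - newTail G B p i l * (1 : Matrix (Fin n) (Fin n) ℝ) j k := by
  have h0 := hB0 p hp
  have e : ∀ m, newMetric G B p j m * riemann (newMetric G B) p i m k l =
      B p * ((1 : Matrix (Fin n) (Fin n) ℝ) i k * (G p j m * hessCov G B p m l)
        - (1 : Matrix (Fin n) (Fin n) ℝ) i l * (G p j m * hessCov G B p m k)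
        + hess G B p i k * (G p j m * (G p)⁻¹ m l) - hess G B p i l * (G p j m * (G p)⁻¹ m k))
      - gradInner G B B p * ((1 : Matrix (Fin n) (Fin n) ℝ) i k * (G p j m * (G p)⁻¹ m l)
        - (1 : Matrix (Fin n) (Fin n) ℝ) i l * (G p j m * (G p)⁻¹ m k)) := by
    intro m
    rw [riemann_newMetric hU hG hB hB0 hp, hflat p hp, hessCov_symm hU hG hB hp l m,
      hessCov_symm hU hG hB hp k m, hG.inv_symm hp l m, hG.inv_symm hp k m]
    simp only [newMetric, Matrix.smul_apply, smul_eq_mul]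
    field_simp
    ring
  simp only [curvature, e, Finset.sum_add_distrib, Finset.sum_sub_distrib, ← Finset.mul_sum,
    hG.sum_metric_mul_inv hp, ← hess_apply, newTail_apply]
  ring

theorem isConformallyFlat_newMetric (hU : IsOpen U) (hG : IsMetric U G) (hflat : IsFlat U G)
    (hB : ContDiffOn ℝ ∞ B U) (hB0 : ∀ p ∈ U, B p ≠ 0) :
    IsConformallyFlat U (newMetric G B) := by
  intro p hp
  have hc : ContDiffOn ℝ ∞ (fun q => (B q ^ 2)⁻¹) U :=
    (hB.pow 2).inv fun q hq => pow_ne_zero 2 (hB0 q hq)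
  have hc0 : ∀ q ∈ U, 0 < (B q ^ 2)⁻¹ := fun q hq => inv_pos.2 (by have := hB0 q hq; positivity)
  have heq : ∀ q ∈ U, (B q ^ 2)⁻¹ • newMetric G B q = G q := by
    intro q hq
    rw [newMetric, smul_smul, inv_mul_cancel₀ (pow_ne_zero 2 (hB0 q hq)), one_smul]
  refine ⟨U, hU, hp, subset_rfl, _, hc, hc0,
    (isMetric_newMetric hG hB hB0).smul hc fun q hq => (hc0 q hq).ne', ?_⟩
  intro q hq i j k l
  -- The rescaled metric equals `G` on `U` only, so equality of derivatives is drawn from equality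
  -- on an open set.
  have hinv : ∀ a b, ∀ q ∈ U, ((B q ^ 2)⁻¹ • newMetric G B q)⁻¹ a b = (G q)⁻¹ a b :=
    fun a b q hq => by rw [heq q hq]
  have hchr : ∀ q ∈ U, ∀ a b c, christoffel (fun q => (B q ^ 2)⁻¹ • newMetric G B q) q a b c =
      christoffel G q a b c := by
    intro q hq a b c
    simp only [christoffel, heq q hq, pd_congr hU hq (hinv _ _)]
  rw [← hflat q hq i j k l]
  simp only [riemann, hchr q hq, pd_congr hU hq fun r hr => hchr r hr _ _ _]

end ConformalCurvature

/-! ### Hamiltonian systems: the matrix as a Hessian, and the new Hamiltonian form. -/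

section Systems

variable {n m : ℕ} {U : Set (V n)} {G : V n → Matrix (Fin n) (Fin n) ℝ} {B : V n → ℝ} {p : V n}

/-- On the differential of a function the local part becomes the covariant Hessian: the derivative
along the curve supplies the second partial derivatives, the Christoffel term the correction. -/
theorem act_gradAlong (O : HydroOp n m) (hU : IsOpen U) {h : V n → ℝ} (hh : ContDiffOn ℝ ∞ h U)
    {u : ℝ → V n} {x : ℝ} (hu : DifferentiableAt ℝ u x) (hux : u x ∈ U)
    (φ : Fin m → ℝ → ℝ) :
    O.act u (gradAlong h u) φ x = hess O.metric h (u x) *ᵥ deriv u x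
      + ∑ α, φ α x • (O.left α (u x) *ᵥ deriv u x) := by
  have hd : deriv (gradAlong h u) x =
      fun j => ∑ k, pd k (fun q => pd j h q) (u x) * deriv u x k := by
    apply HasDerivAt.deriv
    rw [hasDerivAt_pi]
    intro j
    exact hasDerivAt_comp_curve (contDiffOn_differentiableAt hU (contDiffOn_pd hU hh j) hux)
      hu.hasDerivAt rfl
  have e : ∀ i, (∑ j, O.metric (u x) i j * ∑ k, pd k (fun q => pd j h q) (u x) * deriv u x k)
      - ∑ j, ∑ s, ∑ k, O.metric (u x) i s * christoffel O.metric (u x) j s k * deriv u x k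
        * gradAlong h u x j = ∑ k, hess O.metric h (u x) i k * deriv u x k := by
    intro i
    have e1 : ∑ k, (∑ j, O.metric (u x) i j * pd k (fun q => pd j h q) (u x)) * deriv u x k =
        ∑ j, O.metric (u x) i j * ∑ k, pd k (fun q => pd j h q) (u x) * deriv u x k := by
      simp only [Finset.sum_mul, Finset.mul_sum]
      rw [Finset.sum_comm]
      exact Finset.sum_congr rfl fun _ _ => Finset.sum_congr rfl fun _ _ => by ring
    have e2 : ∑ k, (∑ s, O.metric (u x) i s *
          ∑ j, christoffel O.metric (u x) j s k * pd j h (u x)) * deriv u x k =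
        ∑ j, ∑ s, ∑ k, O.metric (u x) i s * christoffel O.metric (u x) j s k * deriv u x k
          * gradAlong h u x j := by
      simp only [Finset.sum_mul, Finset.mul_sum, gradAlong]
      have c : ∀ k, ∑ s, ∑ j, O.metric (u x) i s *
          (christoffel O.metric (u x) j s k * pd j h (u x)) * deriv u x k =
          ∑ j, ∑ s, O.metric (u x) i s * christoffel O.metric (u x) j s k * deriv u x k
          * pd j h (u x) := by
        intro k
        rw [Finset.sum_comm]
        exact Finset.sum_congr rfl fun _ _ => Finset.sum_congr rfl fun _ _ => by ring
      simp only [c]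
      rw [Finset.sum_comm]
      exact Finset.sum_congr rfl fun _ _ => Finset.sum_comm
    rw [← e1, ← e2, ← Finset.sum_sub_distrib]
    refine Finset.sum_congr rfl fun k _ => ?_
    rw [← sub_mul, ← Finset.sum_sub_distrib]
    congr 1
    simp only [hess_apply, hessCov]
    refine Finset.sum_congr rfl fun s _ => ?_
    rw [pd_comm hU hh hux k s]; ring
  funext i
  simp only [HydroOp.act, hd, e, Pi.add_apply, Finset.sum_apply, Pi.smul_apply, smul_eq_mul,
    Matrix.mulVec, dotProduct]
  congr 1
  exact Finset.sum_congr rfl fun _ _ => mul_comm _ _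

/-- The flow equation is imposed on all germs of curves, so straight lines through `p` in every
direction `η` determine the matrix. -/
theorem eq_hess_of_isHamiltonianSystem (hU : IsOpen U) {h : V n → ℝ}
    (hh : ContDiffOn ℝ ∞ h U) {v : V n → Matrix (Fin n) (Fin n) ℝ}
    (hv : IsHamiltonianSystem U v (localOp G) h ![]) (hp : p ∈ U) : v p = hess G h p := by
  refine Matrix.mulVec_injective (funext fun η => ?_)
  have hd : HasDerivAt (fun y : ℝ => p + y • η) η 0 := by
    simpa using ((hasDerivAt_id (0 : ℝ)).smul_const η).const_add p
  have h0 : p + (0 : ℝ) • η = p := by simp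
  have hf := hv.flow (fun y => p + y • η) 0 (by fun_prop) (by simpa [h0] using hp)
  rw [act_gradAlong (localOp G) hU hh hd.differentiableAt (by simpa [h0] using hp),
    hd.deriv] at hf
  simpa [h0, localOp] using hf

theorem pd_of_isConservationLaw {v : V n → Matrix (Fin n) (Fin n) ℝ} {A : V n → ℝ}
    (hc : IsConservationLaw U v B A) (hp : p ∈ U) (k : Fin n) :
    pd k A p = ∑ m, pd m B p * v p m k := by
  rw [pd, ← hc p hp, fderiv_eq_sum_pd]
  simp

/-- With `h = B f`, both the Leibniz rule for `B ∇∇h` and the new Hessian of `f` contain `B² ∇∇f`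
and the same mixed gradient terms. Their difference is `f B ∇∇B` and a multiple of the identity,
that is, the two tail terms. -/
theorem isHamiltonianSystem_newMatrix (hU : IsOpen U) (hG : IsMetric U G)
    {h A : V n → ℝ} (hh : ContDiffOn ℝ ∞ h U) (hB : ContDiffOn ℝ ∞ B U) (hA : ContDiffOn ℝ ∞ A U)
    (hB0 : ∀ p ∈ U, B p ≠ 0) {v : V n → Matrix (Fin n) (Fin n) ℝ}
    (hv : ∀ p ∈ U, v p = hess G h p) (hcons : IsConservationLaw U v B A) :
    IsHamiltonianSystem U (newMatrix v B A) (conformalOp (newMetric G B) (newTail G B))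
      (fun p => h p / B p) ![fun p => h p / B p, fun p =>
        B p * gradInner G B (fun p => h p / B p) p + (1 / 2) * (h p / B p) * gradInner G B B p
          - A p] := by
  set f : V n → ℝ := fun p => h p / B p with hf_def
  set P : V n → ℝ := fun p => B p * gradInner G B f p + (1 / 2) * f p * gradInner G B B p - A p
    with hP_def
  have hf : ContDiffOn ℝ ∞ f U := hh.div hB hB0
  have hBf := contDiffOn_gradInner hU hG hB hf
  have hBB := contDiffOn_gradInner hU hG hB hB
  have hP : ContDiffOn ℝ ∞ P U := by fun_prop
  have hd : ∀ {F : V n → ℝ}, ContDiffOn ℝ ∞ F U → ∀ {p}, p ∈ U → DifferentiableAt ℝ F p :=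
    fun hF _ hp => contDiffOn_differentiableAt hU hF hp
  have hpd : ∀ q ∈ U, ∀ j, pd j h q = pd j B q * f q + B q * pd j f q := by
    intro q hq j
    rw [← pd_mul (hd hB hq) (hd hf hq)]
    exact pd_congr hU hq fun r hr => (mul_div_cancel₀ _ (hB0 r hr)).symm
  have hhess : ∀ p ∈ U, ∀ i j, hess G h p i j = B p * hess G f p i j
      + raise G p (grad B p) i * pd j f p + raise G p (grad f p) i * pd j B p
      + f p * hess G B p i j := by
    intro p hp i j
    have e1 : ∀ s, hessCov G h p s j = B p * hessCov G f p s j + pd s B p * pd j f p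
        + pd s f p * pd j B p + f p * hessCov G B p s j := by
      intro s
      have dBj := hd (contDiffOn_pd hU hB j) hp
      have dfj := hd (contDiffOn_pd hU hf j) hp
      simp only [hessCov]
      rw [pd_congr hU hp fun q hq => hpd q hq j, pd_add (dBj.fun_mul (hd hf hp))
        ((hd hB hp).fun_mul dfj), pd_mul dBj (hd hf hp), pd_mul (hd hB hp) dfj]
      have e2 : ∀ k, christoffel G p k s j * pd k h p =
          f p * (christoffel G p k s j * pd k B p) + B p * (christoffel G p k s j * pd k f p) := by
        intro k; rw [hpd p hp]; ring
      simp only [e2, Finset.sum_add_distrib, ← Finset.mul_sum]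
      ring
    have e3 : ∀ s, G p i s * hessCov G h p s j = B p * (G p i s * hessCov G f p s j)
        + pd j f p * (G p i s * grad B p s) + pd j B p * (G p i s * grad f p s)
        + f p * (G p i s * hessCov G B p s j) := by
      intro s; rw [e1]; simp only [grad]; ring
    simp only [hess_apply, e3, Finset.sum_add_distrib, ← Finset.mul_sum, raise]
    ring
  -- The function `P` is whatever multiple of the identity remains once the new Hessian of `f` and
  -- `f` times the affinor are subtracted from `B v - A`.
  have hflow : ∀ p ∈ U, newMatrix v B A p = hess (newMetric G B) f p
      + (f p • newTail G B p + P p • (1 : Matrix (Fin n) (Fin n) ℝ)) := by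
    intro p hp
    ext i j
    simp only [newMatrix, Matrix.sub_apply, Matrix.add_apply, Matrix.smul_apply, smul_eq_mul,
      hv p hp, hhess p hp, hess_newMetric hU hG hB hB0 hp, newTail_apply, hP_def]
    ring
  -- Here the conservation law enters: `∂_k A = ∂_m B v^m_k`, expanded by the Leibniz rule, cancels
  -- every term of `∂_k P` except `w^m_k ∂_m f`.
  have hPk : ∀ p ∈ U, ∀ k, pd k P p = ∑ m, newTail G B p m k * pd m f p := by
    intro p hp k
    have d1 := (hd hB hp).fun_mul (hd hBf hp)
    have d2 := (hd hf hp).const_mul (1 / 2)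
    have d3 := d2.fun_mul (hd hBB hp)
    have e1 : ∀ m, pd m B p * v p m k = B p * (hess G f p m k * pd m B p)
        + pd k f p * (pd m B p * raise G p (grad B p) m)
        + pd k B p * (pd m B p * raise G p (grad f p) m)
        + f p * (hess G B p m k * pd m B p) := by
      intro m; rw [hv p hp, hhess p hp]; ring
    have e2 : ∀ m, newTail G B p m k * pd m f p = B p * (hess G B p m k * pd m f p)
        - (1 / 2) * gradInner G B B p * (pd m f p * (1 : Matrix (Fin n) (Fin n) ℝ) m k) := by
      intro m; rw [newTail_apply]; ring
    have e3 := sum_mul_one k (fun m => pd m f p)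
    rw [hP_def, pd_sub (d1.fun_add d3) (hd hA hp), pd_add d1 d3, pd_mul (hd hB hp) (hd hBf hp),
      pd_mul d2 (hd hBB hp), pd_const_mul _ (hd hf hp), pd_gradInner hU hG hp hB hf,
      pd_gradInner hU hG hp hB hB, pd_of_isConservationLaw hcons hp]
    simp only [e1, e2, e3, Finset.sum_add_distrib, Finset.sum_sub_distrib, ← Finset.mul_sum]
    simp only [gradInner]
    ring
  refine ⟨?_, ?_, ?_⟩
  · intro α
    fin_cases α
    · exact hf
    · exact hP
  · intro u x hu hux α
    have hu' := (hu.differentiableAt (by simp)).hasDerivAt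
    fin_cases α
    · refine (hasDerivAt_comp_curve (hd hf hux) hu' rfl).congr_deriv ?_
      simp only [HydroOp.integrand, conformalOp, gradAlong]
      refine Finset.sum_congr rfl fun j _ => ?_
      simp [Matrix.one_apply, mul_comm]
    · refine (hasDerivAt_comp_curve (hd hP hux) hu' rfl).congr_deriv ?_
      simp only [HydroOp.integrand, conformalOp, gradAlong, hPk _ hux, Finset.sum_mul]
      rw [Finset.sum_comm]
      refine Finset.sum_congr rfl fun j _ => Finset.sum_congr rfl fun _ _ => ?_
      simp; ring
  · intro u x hu hux
    rw [act_gradAlong _ hU hf (hu.differentiableAt (by simp)) hux,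
      hflow _ hux, Matrix.add_mulVec, Matrix.add_mulVec, Matrix.smul_mulVec, Matrix.smul_mulVec]
    simp [conformalOp, Fin.sum_univ_two]

end Systems

/-! ### The reciprocal transformation of solutions. -/

section Reciprocal

/-- The linear automorphism `(x, t) ↦ (b x + a t, t)` of the plane. -/
def shearEquiv (a b : ℝ) (hb : b ≠ 0) : (ℝ × ℝ) ≃L[ℝ] (ℝ × ℝ) :=
  ContinuousLinearEquiv.equivOfInverse
    ((b • ContinuousLinearMap.fst ℝ ℝ ℝ + a • ContinuousLinearMap.snd ℝ ℝ ℝ).prod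
      (ContinuousLinearMap.snd ℝ ℝ ℝ))
    ((b⁻¹ • (ContinuousLinearMap.fst ℝ ℝ ℝ - a • ContinuousLinearMap.snd ℝ ℝ ℝ)).prod
      (ContinuousLinearMap.snd ℝ ℝ ℝ))
    (fun z => by ext <;> simp; field_simp)
    (fun z => by ext <;> simp; field_simp; ring)

theorem coe_shearEquiv (a b : ℝ) (hb : b ≠ 0) :
    (shearEquiv a b hb : (ℝ × ℝ) →L[ℝ] (ℝ × ℝ)) =
      (b • ContinuousLinearMap.fst ℝ ℝ ℝ + a • ContinuousLinearMap.snd ℝ ℝ ℝ).prod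
        (ContinuousLinearMap.snd ℝ ℝ ℝ) := rfl

variable {n : ℕ} {U : Set (V n)} {v : V n → Matrix (Fin n) (Fin n) ℝ} {B A : V n → ℝ}
  {D : Set (ℝ × ℝ)} {u : ℝ × ℝ → V n} {X : ℝ × ℝ → ℝ} {u' : ℝ × ℝ → V n}

theorem IsReciprocal.contDiffOn (hR : IsReciprocal B A D u X u') (hu : IsSolution U v D u)
    (hB : ContDiffOn ℝ ∞ B U) (hA : ContDiffOn ℝ ∞ A U) : ContDiffOn ℝ ∞ X D := by
  rw [contDiffOn_infty_iff_fderiv_of_isOpen hu.isOpen]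
  refine ⟨fun z hz => (hR.dX z hz).differentiableAt.differentiableWithinAt, ?_⟩
  have hBu : ContDiffOn ℝ ∞ (fun z => B (u z)) D := hB.comp hu.smooth hu.mem
  have hAu : ContDiffOn ℝ ∞ (fun z => A (u z)) D := hA.comp hu.smooth hu.mem
  exact ((hBu.smul contDiffOn_const).add (hAu.smul contDiffOn_const)).congr
    fun z hz => (hR.dX z hz).fderiv

/-- The differential of `(x, t) ↦ (X, t)` is a shear, invertible because `B ≠ 0`, so the inverse
function theorem applies. No global injectivity of the map is needed. -/
theorem IsReciprocal.exists_localInverse (hR : IsReciprocal B A D u X u')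
    (hu : IsSolution U v D u) (hB : ContDiffOn ℝ ∞ B U) (hA : ContDiffOn ℝ ∞ A U)
    (hB0 : ∀ p ∈ U, B p ≠ 0) {z : ℝ × ℝ} (hz : z ∈ D) :
    ∃ ψ : ℝ × ℝ → ℝ × ℝ, ContDiffAt ℝ ∞ ψ (X z, z.2) ∧ ψ (X z, z.2) = z ∧
      ∀ᶠ w in 𝓝 (X z, z.2), ψ w ∈ D ∧ (X (ψ w), (ψ w).2) = w := by
  have hX := (hR.contDiffOn hu hB hA).contDiffAt (hu.isOpen.mem_nhds hz)
  have hΦ : ContDiffAt ℝ ∞ (fun z : ℝ × ℝ => (X z, z.2)) z := hX.prodMk contDiffAt_snd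
  have hΦ' : HasFDerivAt (fun z : ℝ × ℝ => (X z, z.2))
      (shearEquiv (A (u z)) (B (u z)) (hB0 _ (hu.mem z hz)) : (ℝ × ℝ) →L[ℝ] (ℝ × ℝ)) z := by
    rw [coe_shearEquiv]
    exact (hR.dX z hz).prodMk hasFDerivAt_snd
  have hs := hΦ.hasStrictFDerivAt' hΦ' (by simp)
  have hψ : ContDiffAt ℝ ∞ (hs.localInverse _ _ _) (X z, z.2) := hΦ.to_localInverse hΦ' (by simp)
  have hψz : hs.localInverse _ _ _ (X z, z.2) = z := hs.localInverse_apply_image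
  refine ⟨hs.localInverse _ _ _, hψ, hψz, Filter.Eventually.and ?_ hs.eventually_right_inverse⟩
  exact hψ.continuousAt.eventually_mem (by rw [hψz]; exact hu.isOpen.mem_nhds hz)

/-- Local inverses show that the image is open and that `u'` is smooth there. The chain rule gives
`u_x = B u'_x̃` and `u_t = A u'_x̃ + u'_t`, whence `u'_t = (B v - A) u'_x̃`. -/
theorem IsReciprocal.isSolution (hR : IsReciprocal B A D u X u') (hu : IsSolution U v D u)
    (hB : ContDiffOn ℝ ∞ B U) (hA : ContDiffOn ℝ ∞ A U) (hB0 : ∀ p ∈ U, B p ≠ 0) :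
    IsSolution U (newMatrix v B A) ((fun z => (X z, z.2)) '' D) u' := by
  have hsm : ∀ z ∈ D, ContDiffAt ℝ ∞ u' (X z, z.2) := by
    intro z hz
    obtain ⟨ψ, hψ, hψz, hev⟩ := hR.exists_localInverse hu hB hA hB0 hz
    have huz : ContDiffAt ℝ ∞ u (ψ (X z, z.2)) := by
      rw [hψz]; exact hu.smooth.contDiffAt (hu.isOpen.mem_nhds hz)
    refine (huz.comp _ hψ).congr_of_eventuallyEq ?_
    filter_upwards [hev] with w hw
    rw [Function.comp_apply, ← hR.field _ hw.1, hw.2]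
  refine ⟨?_, ?_, ?_, ?_⟩
  · rw [isOpen_iff_mem_nhds]
    rintro _ ⟨z, hz, rfl⟩
    obtain ⟨ψ, -, -, hev⟩ := hR.exists_localInverse hu hB hA hB0 hz
    filter_upwards [hev] with w hw
    exact ⟨ψ w, hw.1, hw.2⟩
  · rintro _ ⟨z, hz, rfl⟩
    exact (hsm z hz).contDiffWithinAt
  · rintro _ ⟨z, hz, rfl⟩
    rw [hR.field z hz]
    exact hu.mem z hz
  · rintro _ ⟨z, hz, rfl⟩
    have hL := ((hsm z hz).differentiableAt (by simp)).hasFDerivAt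
    set L := fderiv ℝ u' (X z, z.2)
    have hcomp : HasFDerivAt u (L.comp ((B (u z) • ContinuousLinearMap.fst ℝ ℝ ℝ
        + A (u z) • ContinuousLinearMap.snd ℝ ℝ ℝ).prod (ContinuousLinearMap.snd ℝ ℝ ℝ))) z := by
      have h1 : HasFDerivAt (fun z : ℝ × ℝ => (X z, z.2)) _ z :=
        (hR.dX z hz).prodMk hasFDerivAt_snd
      refine (HasFDerivAt.comp (f := fun z : ℝ × ℝ => (X z, z.2)) z hL h1).congr_of_eventuallyEq ?_
      filter_upwards [hu.isOpen.mem_nhds hz] with w hw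
      exact (hR.field w hw).symm
    have line1 : ∀ (a b : ℝ), HasDerivAt (fun x : ℝ => (x, b)) ((1 : ℝ), (0 : ℝ)) a :=
      fun a b => (hasDerivAt_id a).prodMk (hasDerivAt_const a b)
    have line2 : ∀ (a b : ℝ), HasDerivAt (fun t : ℝ => (a, t)) ((0 : ℝ), (1 : ℝ)) b :=
      fun a b => (hasDerivAt_const b a).prodMk (hasDerivAt_id b)
    have e1 := (HasFDerivAt.comp_hasDerivAt (f := fun x : ℝ => (x, z.2)) z.1 hcomp
      (line1 z.1 z.2)).deriv
    have e2 := (HasFDerivAt.comp_hasDerivAt (f := fun t : ℝ => (z.1, t)) z.2 hcomp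
      (line2 z.1 z.2)).deriv
    have e3 := (HasFDerivAt.comp_hasDerivAt (f := fun x : ℝ => (x, z.2)) (X z) hL
      (line1 (X z) z.2)).deriv
    have e4 := (HasFDerivAt.comp_hasDerivAt (f := fun t : ℝ => (X z, t)) z.2 hL
      (line2 (X z) z.2)).deriv
    have h := hu.eq z hz
    simp only [Function.comp_def] at e1 e2 e3 e4
    rw [e1, e2] at h
    have s1 : L (B (u z), 0) = B (u z) • L (1, 0) := by rw [← map_smul]; simp
    have s2 : L (A (u z), 1) = A (u z) • L (1, 0) + L (0, 1) := by
      rw [← map_smul, ← map_add]; simp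
    simp only [ContinuousLinearMap.comp_apply, ContinuousLinearMap.prod_apply,
      add_apply, smul_apply,
      ContinuousLinearMap.coe_fst', ContinuousLinearMap.coe_snd', smul_eq_mul, mul_one, mul_zero,
      add_zero, zero_add, s1, s2, Matrix.mulVec_smul] at h
    rw [e3, e4, hR.field z hz, newMatrix, Matrix.sub_mulVec, Matrix.smul_mulVec,
      Matrix.smul_mulVec, Matrix.one_mulVec, ← h]
    abel

end Reciprocal

/-! ### The skew-symmetric primitive and differentiation under the integral. -/

section Primitives

open MeasureTheory Set

/-- The function vanishes outside `(-R, R)`. -/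
def SuppIn {E : Type*} [Zero E] (R : ℝ) (f : ℝ → E) : Prop := ∀ x, x ∉ Ioo (-R) R → f x = 0

theorem exists_suppIn {E : Type*} [Zero E] [TopologicalSpace E] {f : ℝ → E}
    (hf : HasCompactSupport f) : ∃ R, 0 < R ∧ ∀ R', R ≤ R' → SuppIn R' f := by
  obtain ⟨r, hr⟩ := hf.isCompact.isBounded.subset_closedBall 0
  -- The radius `r` may be negative, hence the absolute value; the added `1` puts the support inside
  -- an open interval, so that the function vanishes at the endpoints.
  refine ⟨|r| + 1, by positivity, fun R' hR' x hx => ?_⟩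
  by_contra h
  have h1 := hr (subset_tsupport f h)
  rw [Metric.mem_closedBall, dist_zero_right, Real.norm_eq_abs] at h1
  have h2 := abs_lt.1 (h1.trans_lt ((le_abs_self r).trans_lt ((lt_add_one |r|).trans_le hR')))
  exact hx h2

theorem SuppIn.hasCompactSupport {E : Type*} [Zero E] [TopologicalSpace E] {R : ℝ} {f : ℝ → E}
    (hf : SuppIn R f) : HasCompactSupport f :=
  HasCompactSupport.intro (isCompact_Icc (a := -R) (b := R)) fun x hx =>
    hf x fun h => hx (Ioo_subset_Icc_self h)

theorem integral_eq_of_suppIn {R : ℝ} {f : ℝ → ℝ} (hs : SuppIn R f) :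
    ∫ x, f x = ∫ x in (-R)..R, f x := by
  refine (intervalIntegral.integral_eq_integral_of_support_subset fun x hx => ?_).symm
  by_contra h
  exact hx (hs x fun h' => h (Ioo_subset_Ioc_self h'))

/-- The primitive of `f` with opposite values at `±R`. -/
def prim (R : ℝ) (f : ℝ → ℝ) (x : ℝ) : ℝ :=
  (∫ y in (-R)..x, f y) - (1 / 2) * ∫ y in (-R)..R, f y

theorem dInv_eq_prim {R : ℝ} {f : ℝ → ℝ} (hf : Continuous f) (hs : SuppIn R f) (x : ℝ) :
    dInv f x = prim R f x := by
  have hi : Integrable f := hf.integrable_of_hasCompactSupport hs.hasCompactSupport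
  have h1 : ∫ y in Iic (-R), f y = 0 :=
    setIntegral_eq_zero_of_forall_eq_zero fun y hy => hs y fun h => not_lt.2 hy h.1
  have h2 := intervalIntegral.integral_Iic_sub_Iic (a := -R) (b := x) hi.integrableOn
    hi.integrableOn
  have h3 := intervalIntegral.integral_Iic_add_Ioi (b := x) hi.integrableOn hi.integrableOn
  rw [integral_eq_of_suppIn hs] at h3
  rw [dInv, prim, ← h2, ← h3, h1]; ring

theorem hasDerivAt_prim (R : ℝ) {f : ℝ → ℝ} (hf : Continuous f) (x : ℝ) :
    HasDerivAt (prim R f) (f x) x :=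
  (intervalIntegral.integral_hasDerivAt_right (hf.intervalIntegrable _ _)
    (hf.stronglyMeasurableAtFilter _ _) hf.continuousAt).sub_const _

theorem continuous_prim (R : ℝ) {f : ℝ → ℝ} (hf : Continuous f) : Continuous (prim R f) :=
  continuous_iff_continuousAt.2 fun x => (hasDerivAt_prim R hf x).continuousAt

theorem contDiff_prim (R : ℝ) {f : ℝ → ℝ} (hf : ContDiff ℝ ∞ f) : ContDiff ℝ ∞ (prim R f) := by
  rw [contDiff_infty_iff_deriv]
  have h := hasDerivAt_prim R hf.continuous
  refine ⟨fun x => (h x).differentiableAt, ?_⟩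
  rwa [show deriv (prim R f) = f from funext fun x => (h x).deriv]

/-- Integration by parts. Both primitives take opposite values at `±R`, so their product takes equal
values there and the boundary terms cancel. -/
theorem prim_skew (R : ℝ) {f g : ℝ → ℝ} (hf : Continuous f) (hg : Continuous g) :
    ∫ x in (-R)..R, g x * prim R f x = - ∫ x in (-R)..R, f x * prim R g x := by
  have hpf := continuous_prim R hf
  have hpg := continuous_prim R hg
  have h := intervalIntegral.integral_eq_sub_of_hasDerivAt (a := -R) (b := R)
    (f := fun x => prim R f x * prim R g x) (f' := fun x => f x * prim R g x + prim R f x * g x)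
    (fun x _ => (hasDerivAt_prim R hf x).mul (hasDerivAt_prim R hg x))
    (Continuous.intervalIntegrable (by fun_prop) _ _)
  rw [intervalIntegral.integral_add (Continuous.intervalIntegrable (by fun_prop) _ _)
    (Continuous.intervalIntegrable (by fun_prop) _ _)] at h
  have e : ∀ f : ℝ → ℝ, prim R f R = - prim R f (-R) := by
    intro f; simp [prim]; ring
  rw [e f, e g] at h
  simp only [mul_comm (g _)]
  linarith

/-- A family of functions, continuous with its derivative in the parameter. -/
structure HasFamilyDeriv (f f' : ℝ → ℝ → ℝ) : Prop where
  cont : Continuous (Function.uncurry f)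
  cont' : Continuous (Function.uncurry f')
  hasDerivAt : ∀ ε x, HasDerivAt (fun ε => f ε x) (f' ε x) ε

namespace HasFamilyDeriv

variable {f f' g g' : ℝ → ℝ → ℝ}

theorem cont_left (h : HasFamilyDeriv f f') (ε : ℝ) : Continuous (f ε) :=
  h.cont.comp (Continuous.prodMk_right ε)

theorem cont_left' (h : HasFamilyDeriv f f') (ε : ℝ) : Continuous (f' ε) :=
  h.cont'.comp (Continuous.prodMk_right ε)

theorem add (hf : HasFamilyDeriv f f') (hg : HasFamilyDeriv g g') :
    HasFamilyDeriv (fun ε x => f ε x + g ε x) (fun ε x => f' ε x + g' ε x) :=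
  ⟨hf.cont.add hg.cont, hf.cont'.add hg.cont',
    fun ε x => (hf.hasDerivAt ε x).add (hg.hasDerivAt ε x)⟩

theorem mul (hf : HasFamilyDeriv f f') (hg : HasFamilyDeriv g g') :
    HasFamilyDeriv (fun ε x => f ε x * g ε x) (fun ε x => f' ε x * g ε x + f ε x * g' ε x) :=
  ⟨hf.cont.mul hg.cont, (hf.cont'.mul hg.cont).add (hf.cont.mul hg.cont'),
    fun ε x => (hf.hasDerivAt ε x).mul (hg.hasDerivAt ε x)⟩

theorem hasDerivAt_integral (hf : HasFamilyDeriv f f') (a b ε : ℝ) :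
    HasDerivAt (fun ε => ∫ x in a..b, f ε x) (∫ x in a..b, f' ε x) ε := by
  -- The dominating constant is the bound of the derivative on a compact rectangle around the given
  -- parameter.
  obtain ⟨C, hC⟩ := ((isCompact_Icc (a := ε - 1) (b := ε + 1)).prod
    (isCompact_uIcc (a := a) (b := b))).exists_bound_of_continuousOn hf.cont'.continuousOn
  refine (intervalIntegral.hasDerivAt_integral_of_dominated_loc_of_deriv_le (bound := fun _ => C)
    (Icc_mem_nhds (sub_one_lt ε) (lt_add_one ε))
    (Filter.Eventually.of_forall fun e => (hf.cont_left e).aestronglyMeasurable)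
    ((hf.cont_left ε).intervalIntegrable _ _) (hf.cont_left' ε).aestronglyMeasurable
    (Filter.Eventually.of_forall fun x hx e he => hC (e, x) ⟨he, uIoc_subset_uIcc hx⟩)
    (continuous_const.intervalIntegrable _ _)
    (Filter.Eventually.of_forall fun x _ e _ => hf.hasDerivAt e x)).2

theorem prim (hf : HasFamilyDeriv f f') (R : ℝ) :
    HasFamilyDeriv (fun ε => prim R (f ε)) (fun ε => HydroRecip.prim R (f' ε)) := by
  have key : ∀ {f : ℝ → ℝ → ℝ}, Continuous (Function.uncurry f) →
      Continuous (Function.uncurry fun ε => HydroRecip.prim R (f ε)) := by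
    intro f h
    have h1 := intervalIntegral.continuous_parametric_primitive_of_continuous
      (μ := volume) (a₀ := -R) h
    have h2 := (intervalIntegral.continuous_parametric_intervalIntegral_of_continuous'
      (μ := volume) h (-R) R).comp (continuous_fst (X := ℝ) (Y := ℝ))
    exact h1.sub (h2.const_mul _)
  refine ⟨key hf.cont, key hf.cont', fun ε x => ?_⟩
  exact (hf.hasDerivAt_integral (-R) x ε).sub ((hf.hasDerivAt_integral (-R) R ε).const_mul _)

theorem of_contDiff {F : ℝ × ℝ → ℝ} (hF : ContDiff ℝ ∞ F) :
    HasFamilyDeriv (fun ε x => F (ε, x)) (fun ε x => deriv (fun e => F (e, x)) ε) := by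
  have h1 : ∀ ε x, HasDerivAt (fun e => F (e, x)) (fderiv ℝ F (ε, x) (1, 0)) ε := fun ε x =>
    HasFDerivAt.comp_hasDerivAt (f := fun e : ℝ => (e, x)) ε
      (hF.differentiable (by simp) (ε, x)).hasFDerivAt
      ((hasDerivAt_id ε).prodMk (hasDerivAt_const ε x))
  refine ⟨hF.continuous, ?_, fun ε x => (h1 ε x).differentiableAt.hasDerivAt⟩
  have h2 : (fun ε x => deriv (fun e => F (e, x)) ε) = fun ε x => fderiv ℝ F (ε, x) (1, 0) :=
    funext fun ε => funext fun x => (h1 ε x).deriv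
  rw [h2]
  exact (hF.continuous_fderiv (by simp)).clm_apply continuous_const

end HasFamilyDeriv

end Primitives

/-! ### Connection, Codazzi equation and curvature in matrix form along curves. -/

section TensorsAlongCurves

variable {n : ℕ} {U : Set (V n)} {G w : V n → Matrix (Fin n) (Fin n) ℝ} {p : V n}

/-- The connection matrix `Γ^j_{sk} Xᵏ`. -/
def conn (G : V n → Matrix (Fin n) (Fin n) ℝ) (p X : V n) : Matrix (Fin n) (Fin n) ℝ :=
  Matrix.of fun j s => ∑ k, christoffel G p j s k * X k

/-- The derivative of the connection matrix `Γ(Y)` along `X`, for constant `Y`. -/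
def dconn (G : V n → Matrix (Fin n) (Fin n) ℝ) (p X Y : V n) : Matrix (Fin n) (Fin n) ℝ :=
  Matrix.of fun j s => ∑ k, (∑ l, pd l (fun q => christoffel G q j s k) p * X l) * Y k

/-- The derivative of a matrix field along `X`. -/
def dmat (w : V n → Matrix (Fin n) (Fin n) ℝ) (p X : V n) : Matrix (Fin n) (Fin n) ℝ :=
  Matrix.of fun i j => ∑ l, pd l (fun q => w q i j) p * X l

theorem hasDerivAt_mulVec {M : ℝ → Matrix (Fin n) (Fin n) ℝ} {M' : Matrix (Fin n) (Fin n) ℝ}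
    {Y : ℝ → V n} {Y' : V n} {t : ℝ} (hM : ∀ i j, HasDerivAt (fun s => M s i j) (M' i j) t)
    (hY : HasDerivAt Y Y' t) :
    HasDerivAt (fun s => M s *ᵥ Y s) (M' *ᵥ Y t + M t *ᵥ Y') t := by
  rw [hasDerivAt_pi] at hY ⊢
  intro i
  simp only [Matrix.mulVec, dotProduct, Pi.add_apply, ← Finset.sum_add_distrib]
  exact HasDerivAt.fun_sum fun j _ => (hM i j).fun_mul (hY j)

theorem hasDerivAt_dotProduct {a b : ℝ → V n} {a' b' : V n} {t : ℝ} (ha : HasDerivAt a a' t)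
    (hb : HasDerivAt b b' t) :
    HasDerivAt (fun s => a s ⬝ᵥ b s) (a' ⬝ᵥ b t + a t ⬝ᵥ b') t := by
  rw [hasDerivAt_pi] at ha hb
  simp only [dotProduct, ← Finset.sum_add_distrib]
  exact HasDerivAt.fun_sum fun j _ => (ha j).fun_mul (hb j)

theorem hasDerivAt_matrix_curve (hU : IsOpen U)
    (hw : ∀ i j, ContDiffOn ℝ ∞ (fun q => w q i j) U) {γ : ℝ → V n} {X : V n} {t : ℝ}
    (hγ : HasDerivAt γ X t) (hp : γ t ∈ U) (i j : Fin n) :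
    HasDerivAt (fun s => w (γ s) i j) (dmat w (γ t) X i j) t :=
  hasDerivAt_comp_curve (contDiffOn_differentiableAt hU (hw i j) hp) hγ rfl

theorem dmat_metric (hU : IsOpen U) (hG : IsMetric U G) (hp : p ∈ U) (X : V n) :
    dmat G p X = -(conn G p X * G p + G p * (conn G p X)ᵀ) := by
  ext i j
  simp only [dmat, conn, Matrix.of_apply, Matrix.neg_apply, Matrix.add_apply, Matrix.mul_apply,
    Matrix.transpose_apply, hG.pd_metric hU hp, Finset.sum_mul, Finset.mul_sum, neg_mul,
    Finset.sum_neg_distrib, Finset.sum_add_distrib, add_mul]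
  congr 2
  · rw [Finset.sum_comm]
    refine Finset.sum_congr rfl fun m _ => Finset.sum_congr rfl fun l _ => ?_
    rw [hG.christoffel_symm hU hp i l m]; ring
  · rw [Finset.sum_comm]
    refine Finset.sum_congr rfl fun m _ => Finset.sum_congr rfl fun l _ => ?_
    rw [hG.christoffel_symm hU hp j l m]; ring

theorem hasDerivAt_conn_curve (hU : IsOpen U) (hG : IsMetric U G) {γ Y : ℝ → V n} {X Y' : V n}
    {t : ℝ} (hγ : HasDerivAt γ X t) (hY : HasDerivAt Y Y' t) (hp : γ t ∈ U) (j s : Fin n) :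
    HasDerivAt (fun r => conn G (γ r) (Y r) j s)
      ((dconn G (γ t) X (Y t) + conn G (γ t) Y') j s) t := by
  rw [hasDerivAt_pi] at hY
  simp only [conn, dconn, Matrix.of_apply, Matrix.add_apply, ← Finset.sum_add_distrib]
  exact HasDerivAt.fun_sum fun k _ => (hasDerivAt_comp_curve
    (contDiffOn_differentiableAt hU (hG.contDiffOn_christoffel hU j s k) hp) hγ rfl).fun_mul (hY k)

/-- Vanishing of the torsion. -/
theorem conn_mulVec_comm (hU : IsOpen U) (hG : IsMetric U G) (hp : p ∈ U) (X Y : V n) :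
    conn G p X *ᵥ Y = conn G p Y *ᵥ X := by
  ext j
  simp only [conn, Matrix.mulVec, dotProduct, Matrix.of_apply, Finset.sum_mul]
  rw [Finset.sum_comm]
  refine Finset.sum_congr rfl fun a _ => Finset.sum_congr rfl fun b _ => ?_
  rw [hG.christoffel_symm hU hp j b a]; ring

/-- The Codazzi equation `∇_k w^i_j = ∇_j w^i_k`, contracted with `Xᵏ` and `Yʲ`. -/
theorem dmat_codazzi (hU : IsOpen U) (hG : IsMetric U G) (hp : p ∈ U)
    (hcod : ∀ i j k : Fin n, covDeriv G w p k i j = covDeriv G w p j i k) (X Y : V n) :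
    dmat w p X *ᵥ Y - dmat w p Y *ᵥ X =
      conn G p Y *ᵥ (w p *ᵥ X) - conn G p X *ᵥ (w p *ᵥ Y) := by
  ext i
  have h1 : ∀ j k, pd k (fun q => w q i j) p - pd j (fun q => w q i k) p =
      ∑ m, christoffel G p i m j * w p m k - ∑ m, christoffel G p i m k * w p m j := by
    intro j k
    have h := hcod i j k
    simp only [covDeriv, Finset.sum_sub_distrib] at h
    simp only [hG.christoffel_symm hU hp _ k j] at h
    simp only [hG.christoffel_symm hU hp i _ j, hG.christoffel_symm hU hp i _ k]
    linarith
  have h2 : ∀ X Y : V n, (dmat w p X *ᵥ Y) i = ∑ j, ∑ k, pd k (fun q => w q i j) p * X k * Y j := by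
    intro X Y
    simp only [dmat, Matrix.mulVec, dotProduct, Matrix.of_apply, Finset.sum_mul]
  have h3 : ∀ X Y : V n, (conn G p Y *ᵥ (w p *ᵥ X)) i =
      ∑ j, ∑ k, (∑ m, christoffel G p i m j * w p m k) * X k * Y j := by
    intro X Y
    simp only [conn, Matrix.mulVec, dotProduct, Matrix.of_apply, Finset.sum_mul_sum]
    rw [Finset.sum_comm]
    refine Finset.sum_congr rfl fun j _ => ?_
    rw [Finset.sum_comm]
    refine Finset.sum_congr rfl fun k _ => ?_
    rw [Finset.sum_mul, Finset.sum_mul]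
    exact Finset.sum_congr rfl fun m _ => by ring
  rw [Pi.sub_apply, Pi.sub_apply, h2, h2, h3, h3]
  have sw : ∀ F : Fin n → Fin n → ℝ, ∑ j, ∑ k, F j k * Y k * X j = ∑ j, ∑ k, F k j * X k * Y j := by
    intro F
    rw [Finset.sum_comm]
    exact Finset.sum_congr rfl fun _ _ => Finset.sum_congr rfl fun _ _ => by ring
  rw [sw (fun j k => pd k (fun q => w q i j) p),
    sw (fun j k => ∑ m, christoffel G p i m j * w p m k)]
  simp only [← Finset.sum_sub_distrib]
  refine Finset.sum_congr rfl fun j _ => Finset.sum_congr rfl fun k _ => ?_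
  rw [← sub_mul, ← sub_mul, ← sub_mul, ← sub_mul, h1]

/-- The curvature operator, contracted with `Xᵏ` and `Yˡ`. -/
theorem dconn_curvature (hU : IsOpen U) (hG : IsMetric U G) (hp : p ∈ U) (X Y : V n) (i j : Fin n) :
    (dconn G p X Y - dconn G p Y X + conn G p X * conn G p Y - conn G p Y * conn G p X) i j =
      ∑ k, ∑ l, riemann G p i j k l * X k * Y l := by
  have hpc : ∀ l k, pd l (fun q => christoffel G q i j k) p =
      pd l (fun q => christoffel G q i k j) p :=
    fun l k => pd_congr hU hp fun q hq => hG.christoffel_symm hU hq i j k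
  have h1 : ∀ X Y : V n, dconn G p X Y i j =
      ∑ k, ∑ l, pd k (fun q => christoffel G q i l j) p * X k * Y l := by
    intro X Y
    simp only [dconn, Matrix.of_apply, Finset.sum_mul, hpc]
    rw [Finset.sum_comm]
  have h2 : ∀ X Y : V n, (conn G p X * conn G p Y) i j =
      ∑ k, ∑ l, (∑ m, christoffel G p i k m * christoffel G p m l j) * X k * Y l := by
    intro X Y
    simp only [conn, Matrix.mul_apply, Matrix.of_apply, Finset.sum_mul_sum]
    rw [Finset.sum_comm]
    refine Finset.sum_congr rfl fun k _ => ?_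
    rw [Finset.sum_comm]
    refine Finset.sum_congr rfl fun l _ => ?_
    rw [Finset.sum_mul, Finset.sum_mul]
    refine Finset.sum_congr rfl fun m _ => ?_
    rw [hG.christoffel_symm hU hp i m k, hG.christoffel_symm hU hp m j l]; ring
  have sw : ∀ F : Fin n → Fin n → ℝ, ∑ k, ∑ l, F k l * Y k * X l = ∑ k, ∑ l, F l k * X k * Y l := by
    intro F
    rw [Finset.sum_comm]
    exact Finset.sum_congr rfl fun _ _ => Finset.sum_congr rfl fun _ _ => by ring
  rw [Matrix.sub_apply, Matrix.add_apply, Matrix.sub_apply, h1, h1, h2, h2,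
    sw (fun k l => pd k (fun q => christoffel G q i l j) p),
    sw (fun k l => ∑ m, christoffel G p i k m * christoffel G p m l j),
    ← Finset.sum_sub_distrib, ← Finset.sum_add_distrib, ← Finset.sum_sub_distrib]
  refine Finset.sum_congr rfl fun k _ => ?_
  rw [← Finset.sum_sub_distrib, ← Finset.sum_add_distrib, ← Finset.sum_sub_distrib]
  refine Finset.sum_congr rfl fun l _ => ?_
  rw [riemann, Finset.sum_sub_distrib]
  ring

end TensorsAlongCurves

/-! ### Pointwise algebra of the Jacobi identity. -/

section JacobiIntegrand

variable {n : ℕ} {U : Set (V n)} {G w : V n → Matrix (Fin n) (Fin n) ℝ} {p : V n}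

/-- The affinor `w` and the metric satisfy
`R^{ij}_{kl} = w^i_k δ^j_l + w^j_l δ^i_k - w^j_k δ^i_l - w^i_l δ^j_k` at `p`. -/
def HasConformalCurvature (G w : V n → Matrix (Fin n) (Fin n) ℝ) (p : V n) : Prop :=
  ∀ i j k l : Fin n, curvature G p i j k l =
      w p i k * (1 : Matrix (Fin n) (Fin n) ℝ) j l + w p j l * (1 : Matrix (Fin n) (Fin n) ℝ) i k
      - w p j k * (1 : Matrix (Fin n) (Fin n) ℝ) i l - w p i l * (1 : Matrix (Fin n) (Fin n) ℝ) j k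

/-- Raising the index of the curvature operator of `dconn_curvature` makes the left side
`R^{is}_{kl} ζ_i η_s X^k Y^l`. With `Y = u_x` the four products on the right are those that arise
when the primitives in the tail are differentiated. -/
theorem dotProduct_curvature (hU : IsOpen U) (hG : IsMetric U G) (hp : p ∈ U)
    (hR : HasConformalCurvature G w p) (η ζ X Y : V n) :
    η ⬝ᵥ (G p *ᵥ ((dconn G p X Y - dconn G p Y X + conn G p X * conn G p Y
        - conn G p Y * conn G p X)ᵀ *ᵥ ζ)) =
      (ζ ⬝ᵥ (w p *ᵥ X)) * (η ⬝ᵥ Y) + (η ⬝ᵥ (w p *ᵥ Y)) * (ζ ⬝ᵥ X)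
        - (η ⬝ᵥ (w p *ᵥ X)) * (ζ ⬝ᵥ Y) - (ζ ⬝ᵥ (w p *ᵥ Y)) * (η ⬝ᵥ X) := by
  have h1 : ∀ s i, ∑ j, G p s j * ∑ k, ∑ l, riemann G p i j k l * X k * Y l =
      (w p *ᵥ X) i * Y s + (w p *ᵥ Y) s * X i - (w p *ᵥ X) s * Y i - (w p *ᵥ Y) i * X s := by
    intro s i
    have h2 : ∑ j, G p s j * ∑ k, ∑ l, riemann G p i j k l * X k * Y l =
        ∑ k, ∑ l, curvature G p i s k l * X k * Y l := by
      simp only [curvature, Finset.sum_mul, Finset.mul_sum]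
      rw [Finset.sum_comm]
      refine Finset.sum_congr rfl fun k _ => ?_
      rw [Finset.sum_comm]
      exact Finset.sum_congr rfl fun _ _ => Finset.sum_congr rfl fun _ _ => by ring
    have h3 : ∀ k, ∑ l, curvature G p i s k l * X k * Y l =
        w p i k * X k * Y s + (X k * (1 : Matrix (Fin n) (Fin n) ℝ) k i) * (w p *ᵥ Y) s
        - w p s k * X k * Y i - (X k * (1 : Matrix (Fin n) (Fin n) ℝ) k s) * (w p *ᵥ Y) i := by
      intro k
      have h4 : ∀ l, curvature G p i s k l * X k * Y l =
          w p i k * X k * ((1 : Matrix (Fin n) (Fin n) ℝ) s l * Y l)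
          + (X k * (1 : Matrix (Fin n) (Fin n) ℝ) k i) * (w p s l * Y l)
          - w p s k * X k * ((1 : Matrix (Fin n) (Fin n) ℝ) i l * Y l)
          - (X k * (1 : Matrix (Fin n) (Fin n) ℝ) k s) * (w p i l * Y l) := by
        intro l; rw [hR, one_symm k i, one_symm k s]; ring
      simp only [h4, Finset.sum_add_distrib, Finset.sum_sub_distrib, ← Finset.mul_sum, sum_one_mul]
      rfl
    rw [h2]
    simp only [h3, Finset.sum_add_distrib, Finset.sum_sub_distrib, ← Finset.sum_mul, sum_mul_one]
    simp only [Matrix.mulVec, dotProduct]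
    ring
  have h5 : η ⬝ᵥ (G p *ᵥ ((dconn G p X Y - dconn G p Y X + conn G p X * conn G p Y
        - conn G p Y * conn G p X)ᵀ *ᵥ ζ)) = ∑ s, ∑ i, η s * ζ i *
          ∑ j, G p s j * ∑ k, ∑ l, riemann G p i j k l * X k * Y l := by
    simp only [dotProduct, Matrix.mulVec, Matrix.transpose_apply, dconn_curvature hU hG hp]
    refine Finset.sum_congr rfl fun s _ => ?_
    simp only [Finset.mul_sum]
    rw [Finset.sum_comm]
    refine Finset.sum_congr rfl fun i _ => Finset.sum_congr rfl fun j _ => ?_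
    simp only [Finset.sum_mul, Finset.mul_sum]
    exact Finset.sum_congr rfl fun _ _ => Finset.sum_congr rfl fun _ _ => by ring
  have h6 : ∀ a b c d : V n, (a ⬝ᵥ c) * (b ⬝ᵥ d) = ∑ s, ∑ i, a s * b i * (c s * d i) := by
    intro a b c d
    simp only [dotProduct, Finset.sum_mul_sum]
    exact Finset.sum_congr rfl fun _ _ => Finset.sum_congr rfl fun _ _ => by ring
  rw [h5, mul_comm (ζ ⬝ᵥ (w p *ᵥ X)), mul_comm (ζ ⬝ᵥ (w p *ᵥ Y)), h6, h6, h6, h6]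
  simp only [h1, ← Finset.sum_add_distrib, ← Finset.sum_sub_distrib]
  exact Finset.sum_congr rfl fun _ _ => Finset.sum_congr rfl fun _ _ => by ring

theorem transpose_mulVec_dotProduct (M : Matrix (Fin n) (Fin n) ℝ) (x y : V n) :
    (Mᵀ *ᵥ x) ⬝ᵥ y = x ⬝ᵥ (M *ᵥ y) := by
  rw [Matrix.mulVec_transpose, Matrix.dotProduct_mulVec]

theorem dotProduct_transpose_mulVec (M : Matrix (Fin n) (Fin n) ℝ) (x y : V n) :
    x ⬝ᵥ (Mᵀ *ᵥ y) = y ⬝ᵥ (M *ᵥ x) := by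
  rw [dotProduct_comm, transpose_mulVec_dotProduct]

theorem dotProduct_symm_mulVec {g : Matrix (Fin n) (Fin n) ℝ} (hg : gᵀ = g) (x y : V n) :
    x ⬝ᵥ (g *ᵥ y) = y ⬝ᵥ (g *ᵥ x) := by
  conv_lhs => rw [← hg, dotProduct_transpose_mulVec]

/-- The terms without total derivative of the linearized bracket, at a point of the curve. Here
`X` is the variation, `C X` its connection matrix, `eη`, `eζ` are the covariant derivatives
of the covectors `η`, `ζ`, and `Jη`, `Jζ` are the values of the operator. -/
def bracketRemainder (w C : Matrix (Fin n) (Fin n) ℝ) (X η ζ eη eζ Jη Jζ : V n)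
    (aη aζ bη bζ : ℝ) : ℝ :=
  -(η ⬝ᵥ (C *ᵥ Jζ)) + ζ ⬝ᵥ (C *ᵥ Jη) - ((eη ⬝ᵥ (w *ᵥ X)) * aζ - (eζ ⬝ᵥ (w *ᵥ X)) * aη
    + (eη ⬝ᵥ X) * bζ - (eζ ⬝ᵥ X) * bη)

/-- The connection terms cancel in pairs by vanishing torsion. After each `J` is expanded, the terms
with `g` cancel in pairs by the symmetry of `g` and `w g`; the other terms have two primitives as
coefficients, and each occurs twice with opposite signs. -/
theorem bracketRemainder_cyclic {w g : Matrix (Fin n) (Fin n) ℝ}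
    {C : V n → Matrix (Fin n) (Fin n) ℝ} (hg : gᵀ = g) (hw : (w * g)ᵀ = w * g)
    (hC : ∀ X Y, C X *ᵥ Y = C Y *ᵥ X) {ξ η ζ eξ eη eζ Jξ Jη Jζ u : V n} {aξ aη aζ bξ bη bζ : ℝ}
    (hξ : Jξ = g *ᵥ eξ + aξ • (w *ᵥ u) + bξ • u) (hη : Jη = g *ᵥ eη + aη • (w *ᵥ u) + bη • u)
    (hζ : Jζ = g *ᵥ eζ + aζ • (w *ᵥ u) + bζ • u) :
    bracketRemainder w (C Jξ) Jξ η ζ eη eζ Jη Jζ aη aζ bη bζ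
      + bracketRemainder w (C Jη) Jη ζ ξ eζ eξ Jζ Jξ aζ aξ bζ bξ
      + bracketRemainder w (C Jζ) Jζ ξ η eξ eη Jξ Jη aξ aη bξ bη = 0 := by
  have hs1 := dotProduct_symm_mulVec hg
  have hs2 := dotProduct_symm_mulVec hw
  simp only [← Matrix.mulVec_mulVec] at hs2
  simp only [bracketRemainder, hC Jη Jξ, hC Jζ Jξ, hC Jζ Jη]
  have key : ∀ {e J e' : V n} {a b : ℝ}, J = g *ᵥ e + a • (w *ᵥ u) + b • u →
      e' ⬝ᵥ (w *ᵥ J) = e' ⬝ᵥ (w *ᵥ (g *ᵥ e)) + a * (e' ⬝ᵥ (w *ᵥ (w *ᵥ u))) + b * (e' ⬝ᵥ (w *ᵥ u))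
      ∧ e' ⬝ᵥ J = e' ⬝ᵥ (g *ᵥ e) + a * (e' ⬝ᵥ (w *ᵥ u)) + b * (e' ⬝ᵥ u) := by
    rintro e J e' a b rfl
    simp only [Matrix.mulVec_add, Matrix.mulVec_smul, dotProduct_add, dotProduct_smul, smul_eq_mul,
      and_self]
  rw [(key (e' := eη) hξ).1, (key (e' := eζ) hξ).1, (key (e' := eη) hξ).2, (key (e' := eζ) hξ).2,
    (key (e' := eζ) hη).1, (key (e' := eξ) hη).1, (key (e' := eζ) hη).2, (key (e' := eξ) hη).2,
    (key (e' := eξ) hζ).1, (key (e' := eη) hζ).1, (key (e' := eξ) hζ).2, (key (e' := eη) hζ).2,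
    hs1 eη eξ, hs1 eζ eξ, hs1 eζ eη, hs2 eη eξ, hs2 eζ eξ, hs2 eζ eη]
  ring

/-- The integrand of the linearized bracket is a total derivative up to `bracketRemainder`. -/
theorem bracket_integrand_eq {g w Cu CX dXu duX CX' dX du : Matrix (Fin n) (Fin n) ℝ}
    {η ζ η' ζ' u X X' : V n} {aη aζ bη bζ : ℝ} (hg : gᵀ = g)
    (hcod : dX *ᵥ u - du *ᵥ X = Cu *ᵥ (w *ᵥ X) - CX *ᵥ (w *ᵥ u)) (htor : CX *ᵥ u = Cu *ᵥ X)
    (hcurv : η ⬝ᵥ (g *ᵥ ((dXu - duX + CX * Cu - Cu * CX)ᵀ *ᵥ ζ)) =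
      (ζ ⬝ᵥ (w *ᵥ X)) * (η ⬝ᵥ u) + (η ⬝ᵥ (w *ᵥ u)) * (ζ ⬝ᵥ X)
        - (η ⬝ᵥ (w *ᵥ X)) * (ζ ⬝ᵥ u) - (ζ ⬝ᵥ (w *ᵥ u)) * (η ⬝ᵥ X)) :
    η ⬝ᵥ (-(CX * g + g * CXᵀ) *ᵥ (ζ' - Cuᵀ *ᵥ ζ) - g *ᵥ ((dXu + CX')ᵀ *ᵥ ζ))
      + ((η ⬝ᵥ (dX *ᵥ u + w *ᵥ X')) * aζ - (ζ ⬝ᵥ X') * bη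
        + (η ⬝ᵥ X') * bζ - (ζ ⬝ᵥ (dX *ᵥ u + w *ᵥ X')) * aη) =
    (-(η' ⬝ᵥ (g *ᵥ (CXᵀ *ᵥ ζ)) + η ⬝ᵥ (-(Cu * g + g * Cuᵀ) *ᵥ (CXᵀ *ᵥ ζ)
          + g *ᵥ ((duX + CX')ᵀ *ᵥ ζ + CXᵀ *ᵥ ζ')))
      + ((η' ⬝ᵥ (w *ᵥ X) + η ⬝ᵥ (du *ᵥ X + w *ᵥ X')) * aζ + (η ⬝ᵥ (w *ᵥ X)) * (ζ ⬝ᵥ u))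
      - ((ζ' ⬝ᵥ (w *ᵥ X) + ζ ⬝ᵥ (du *ᵥ X + w *ᵥ X')) * aη + (ζ ⬝ᵥ (w *ᵥ X)) * (η ⬝ᵥ u))
      + ((η' ⬝ᵥ X + η ⬝ᵥ X') * bζ + (η ⬝ᵥ X) * (ζ ⬝ᵥ (w *ᵥ u)))
      - ((ζ' ⬝ᵥ X + ζ ⬝ᵥ X') * bη + (ζ ⬝ᵥ X) * (η ⬝ᵥ (w *ᵥ u))))
    + bracketRemainder w CX X η ζ (η' - Cuᵀ *ᵥ η) (ζ' - Cuᵀ *ᵥ ζ)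
        (g *ᵥ (η' - Cuᵀ *ᵥ η) + aη • (w *ᵥ u) + bη • u)
        (g *ᵥ (ζ' - Cuᵀ *ᵥ ζ) + aζ • (w *ᵥ u) + bζ • u) aη aζ bη bζ := by
  have hη := congrArg (fun x => η ⬝ᵥ x) hcod
  have hζ := congrArg (fun x => ζ ⬝ᵥ x) hcod
  have s1 : η' ⬝ᵥ (g *ᵥ (CXᵀ *ᵥ ζ)) = ζ ⬝ᵥ (CX *ᵥ (g *ᵥ η')) := by
    rw [dotProduct_symm_mulVec hg, transpose_mulVec_dotProduct]
  have s2 : η ⬝ᵥ (Cu *ᵥ (g *ᵥ (CXᵀ *ᵥ ζ))) = ζ ⬝ᵥ (CX *ᵥ (g *ᵥ (Cuᵀ *ᵥ η))) := by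
    rw [← transpose_mulVec_dotProduct, dotProduct_symm_mulVec hg, transpose_mulVec_dotProduct]
  simp only [bracketRemainder, Matrix.transpose_add, Matrix.transpose_sub, Matrix.transpose_mul,
    Matrix.add_mulVec, Matrix.sub_mulVec, Matrix.neg_mulVec, Matrix.mulVec_add, Matrix.mulVec_sub,
    Matrix.mulVec_smul, dotProduct_add, dotProduct_sub, dotProduct_neg, sub_dotProduct, smul_eq_mul,
    dotProduct_smul, ← Matrix.mulVec_mulVec, transpose_mulVec_dotProduct, htor] at hη hζ hcurv ⊢
  -- The Codazzi equation, with coefficients `aζ` and `-aη`, removes the derivatives of `w`; the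
  -- curvature formula removes the products of two pairings; `s1` and `s2` move the connection
  -- matrix across the symmetric metric.
  linear_combination aζ * hη - aη * hζ - hcurv + s1 - s2

end JacobiIntegrand

/-! ### Smoothness of tensor expressions along smooth maps into `U`. -/

section Composition

variable {n : ℕ} {U : Set (V n)} {G w : V n → Matrix (Fin n) (Fin n) ℝ}
  {E : Type*} [NormedAddCommGroup E] [NormedSpace ℝ E] {γ X Y : E → V n}

theorem contDiff_comp_field {f : V n → ℝ} (hf : ContDiffOn ℝ ∞ f U) (hγ : ContDiff ℝ ∞ γ)
    (hU : ∀ z, γ z ∈ U) : ContDiff ℝ ∞ (fun z => f (γ z)) :=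
  contDiffOn_univ.1 (hf.comp hγ.contDiffOn fun z _ => hU z)

theorem contDiff_mulVec {M : E → Matrix (Fin n) (Fin n) ℝ}
    (hM : ∀ i j, ContDiff ℝ ∞ (fun z => M z i j)) (hY : ContDiff ℝ ∞ Y) :
    ContDiff ℝ ∞ (fun z => M z *ᵥ Y z) := by
  rw [contDiff_pi] at hY ⊢
  intro i
  simp only [Matrix.mulVec, dotProduct]
  exact ContDiff.sum fun j _ => (hM i j).mul (hY j)

theorem contDiff_dotProduct (hX : ContDiff ℝ ∞ X) (hY : ContDiff ℝ ∞ Y) :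
    ContDiff ℝ ∞ (fun z => X z ⬝ᵥ Y z) := by
  rw [contDiff_pi] at hX hY
  simp only [dotProduct]
  exact ContDiff.sum fun j _ => (hX j).mul (hY j)

theorem contDiff_dmat (hU : IsOpen U) (hw : ∀ i j, ContDiffOn ℝ ∞ (fun q => w q i j) U)
    (hγ : ContDiff ℝ ∞ γ) (hγU : ∀ z, γ z ∈ U) (hX : ContDiff ℝ ∞ X) (i j : Fin n) :
    ContDiff ℝ ∞ (fun z => dmat w (γ z) (X z) i j) := by
  rw [contDiff_pi] at hX
  have h := fun l => contDiff_comp_field (contDiffOn_pd hU (hw i j) l) hγ hγU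
  simp only [dmat, Matrix.of_apply]
  exact ContDiff.sum fun l _ => (h l).mul (hX l)

theorem contDiff_conn (hU : IsOpen U) (hG : IsMetric U G) (hγ : ContDiff ℝ ∞ γ)
    (hγU : ∀ z, γ z ∈ U) (hX : ContDiff ℝ ∞ X) (j s : Fin n) :
    ContDiff ℝ ∞ (fun z => conn G (γ z) (X z) j s) := by
  rw [contDiff_pi] at hX
  have h := fun k => contDiff_comp_field (hG.contDiffOn_christoffel hU j s k) hγ hγU
  simp only [conn, Matrix.of_apply]
  exact ContDiff.sum fun l _ => (h l).mul (hX l)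

theorem contDiff_dconn (hU : IsOpen U) (hG : IsMetric U G) (hγ : ContDiff ℝ ∞ γ)
    (hγU : ∀ z, γ z ∈ U) (hX : ContDiff ℝ ∞ X) (hY : ContDiff ℝ ∞ Y) (j s : Fin n) :
    ContDiff ℝ ∞ (fun z => dconn G (γ z) (X z) (Y z) j s) := by
  rw [contDiff_pi] at hX hY
  have h := fun k l =>
    contDiff_comp_field (contDiffOn_pd hU (hG.contDiffOn_christoffel hU j s k) l) hγ hγU
  simp only [dconn, Matrix.of_apply]
  exact ContDiff.sum fun k _ => (ContDiff.sum fun l _ => (h k l).mul (hX l)).mul (hY k)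

end Composition

/-! ### The operator on test covectors: covariant form, skew-symmetry, cutting off variations. -/

section ConformalOperator

variable {n : ℕ} {U : Set (V n)} {G w : V n → Matrix (Fin n) (Fin n) ℝ} {u : ℝ → V n}
  {R : ℝ} {ξ η ζ : ℝ → V n}

theorem contDiff_deriv_curve (hu : ContDiff ℝ ∞ u) : ContDiff ℝ ∞ (deriv u) :=
  (contDiff_infty_iff_deriv.1 hu).2

theorem SuppIn.dotProduct (hζ : SuppIn R ζ) (Y : ℝ → V n) : SuppIn R (fun x => ζ x ⬝ᵥ Y x) := by
  intro x hx
  simp only [hζ x hx, zero_dotProduct]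

/-- The covariant derivative of a covector field along a curve. -/
def covAlong (G : V n → Matrix (Fin n) (Fin n) ℝ) (u ζ : ℝ → V n) (x : ℝ) : V n :=
  deriv ζ x - (conn G (u x) (deriv u x))ᵀ *ᵥ ζ x

/-- The function `ζ_j u_x^j` of `x`. -/
def tailOne (u ζ : ℝ → V n) (x : ℝ) : ℝ := ζ x ⬝ᵥ deriv u x

/-- The function `ζ_j w^j_k u_x^k` of `x`. -/
def tailTwo (w : V n → Matrix (Fin n) (Fin n) ℝ) (u ζ : ℝ → V n) (x : ℝ) : ℝ :=
  ζ x ⬝ᵥ (w (u x) *ᵥ deriv u x)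

theorem contDiff_tailOne (hu : ContDiff ℝ ∞ u) (hζ : ContDiff ℝ ∞ ζ) :
    ContDiff ℝ ∞ (tailOne u ζ) :=
  contDiff_dotProduct hζ (contDiff_deriv_curve hu)

theorem contDiff_tailTwo (hw : ∀ i j, ContDiffOn ℝ ∞ (fun q => w q i j) U) (hu : ContDiff ℝ ∞ u)
    (huU : ∀ x, u x ∈ U) (hζ : ContDiff ℝ ∞ ζ) : ContDiff ℝ ∞ (tailTwo w u ζ) :=
  contDiff_dotProduct hζ (contDiff_mulVec (fun i j => contDiff_comp_field (hw i j) hu huU)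
    (contDiff_deriv_curve hu))

theorem contDiff_covAlong (hU : IsOpen U) (hG : IsMetric U G) (hu : ContDiff ℝ ∞ u)
    (huU : ∀ x, u x ∈ U) (hζ : ContDiff ℝ ∞ ζ) : ContDiff ℝ ∞ (covAlong G u ζ) :=
  (contDiff_deriv_curve hζ).sub (contDiff_mulVec
    (fun i j => contDiff_conn hU hG hu huU (contDiff_deriv_curve hu) j i) hζ)

theorem conformalOp_op_eq (u ζ : ℝ → V n) (x : ℝ) :
    (conformalOp G w).op u ζ x = G (u x) *ᵥ covAlong G u ζ x
      + dInv (tailOne u ζ) x • (w (u x) *ᵥ deriv u x) + dInv (tailTwo w u ζ) x • deriv u x := by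
  have i0 : (conformalOp G w).integrand u ζ 0 = tailOne u ζ := by
    funext y
    simp [HydroOp.integrand, conformalOp, tailOne, dotProduct, Matrix.one_apply, mul_comm]
  have i1 : (conformalOp G w).integrand u ζ 1 = tailTwo w u ζ := by
    funext y
    simp only [HydroOp.integrand, conformalOp, tailTwo, dotProduct, Matrix.mulVec, Finset.mul_sum]
    refine Finset.sum_congr rfl fun _ _ => Finset.sum_congr rfl fun _ _ => ?_
    simp; ring
  have hloc : ∀ i, ∑ j, ∑ s, ∑ k, G (u x) i s * christoffel G (u x) j s k * deriv u x k * ζ x j =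
      ∑ s, G (u x) i s * ((conn G (u x) (deriv u x))ᵀ *ᵥ ζ x) s := by
    intro i
    simp only [conn, Matrix.mulVec, dotProduct, Matrix.transpose_apply, Matrix.of_apply,
      Finset.sum_mul, Finset.mul_sum]
    rw [Finset.sum_comm]
    exact Finset.sum_congr rfl fun _ _ => Finset.sum_congr rfl fun _ _ =>
      Finset.sum_congr rfl fun _ _ => by ring
  funext i
  simp only [HydroOp.op, HydroOp.act, Fin.sum_univ_two, i0, i1]
  have hloc' := hloc i
  simp only [conformalOp] at hloc' ⊢
  rw [hloc']
  simp only [covAlong, Matrix.mulVec_sub, Pi.add_apply, Pi.sub_apply, Pi.smul_apply, smul_eq_mul,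
    Matrix.mulVec, dotProduct]
  simp [Matrix.one_apply]
  ring

theorem conformalOp_op_eq_prim (hw : ∀ i j, ContDiffOn ℝ ∞ (fun q => w q i j) U)
    (hu : ContDiff ℝ ∞ u) (huU : ∀ x, u x ∈ U) (hζ : ContDiff ℝ ∞ ζ) (hs : SuppIn R ζ) (x : ℝ) :
    (conformalOp G w).op u ζ x = G (u x) *ᵥ covAlong G u ζ x
      + prim R (tailOne u ζ) x • (w (u x) *ᵥ deriv u x)
      + prim R (tailTwo w u ζ) x • deriv u x := by
  rw [conformalOp_op_eq, dInv_eq_prim (contDiff_tailOne hu hζ).continuous (hs.dotProduct _),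
    dInv_eq_prim (contDiff_tailTwo hw hu huU hζ).continuous (hs.dotProduct _)]

theorem contDiff_conformalOp_op (hU : IsOpen U) (hG : IsMetric U G)
    (hw : ∀ i j, ContDiffOn ℝ ∞ (fun q => w q i j) U) (hu : ContDiff ℝ ∞ u)
    (huU : ∀ x, u x ∈ U) (hζ : ContDiff ℝ ∞ ζ) (hs : SuppIn R ζ) :
    ContDiff ℝ ∞ ((conformalOp G w).op u ζ) := by
  rw [funext (conformalOp_op_eq_prim (G := G) hw hu huU hζ hs)]
  have hu' := contDiff_deriv_curve hu
  exact ((contDiff_mulVec (fun i j => contDiff_comp_field (hG.smooth i j) hu huU)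
    (contDiff_covAlong hU hG hu huU hζ)).add
    ((contDiff_prim R (contDiff_tailOne hu hζ)).smul
      (contDiff_mulVec (fun i j => contDiff_comp_field (hw i j) hu huU) hu'))).add
    ((contDiff_prim R (contDiff_tailTwo hw hu huU hζ)).smul hu')

theorem pairing_eq_dotProduct (ξ v : ℝ → V n) : pairing ξ v = ∫ x, ξ x ⬝ᵥ v x := rfl

theorem pairing_op_eq (hw : ∀ i j, ContDiffOn ℝ ∞ (fun q => w q i j) U)
    (hu : ContDiff ℝ ∞ u) (huU : ∀ x, u x ∈ U) (hζ : ContDiff ℝ ∞ ζ) (hsη : SuppIn R η)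
    (hsζ : SuppIn R ζ) :
    pairing η ((conformalOp G w).op u ζ) = ∫ x in (-R)..R,
      (η x ⬝ᵥ (G (u x) *ᵥ covAlong G u ζ x) + (tailTwo w u η x * prim R (tailOne u ζ) x
        + tailOne u η x * prim R (tailTwo w u ζ) x)) := by
  rw [pairing_eq_dotProduct, integral_eq_of_suppIn (hsη.dotProduct _)]
  congr 1
  funext x
  rw [conformalOp_op_eq_prim hw hu huU hζ hsζ]
  simp only [dotProduct_add, dotProduct_smul, smul_eq_mul, tailOne, tailTwo]
  ring

/-- The operator of conformally flat type is skew-symmetric. -/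
theorem pairing_op_skew (hU : IsOpen U) (hG : IsMetric U G)
    (hw : ∀ i j, ContDiffOn ℝ ∞ (fun q => w q i j) U) (hu : ContDiff ℝ ∞ u)
    (huU : ∀ x, u x ∈ U) (hη : ContDiff ℝ ∞ η) (hζ : ContDiff ℝ ∞ ζ)
    (hsη : SuppIn R η) (hsζ : SuppIn R ζ) :
    pairing η ((conformalOp G w).op u ζ) = - pairing ζ ((conformalOp G w).op u η) := by
  have c1 : ∀ {η ζ : ℝ → V n}, ContDiff ℝ ∞ η → ContDiff ℝ ∞ ζ →
      Continuous (fun x => η x ⬝ᵥ (G (u x) *ᵥ covAlong G u ζ x)) := fun hη hζ =>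
    (contDiff_dotProduct hη (contDiff_mulVec (fun i j => contDiff_comp_field (hG.smooth i j) hu huU)
      (contDiff_covAlong hU hG hu huU hζ))).continuous
  have c2 : ∀ {η : ℝ → V n}, ContDiff ℝ ∞ η → Continuous (tailOne u η) :=
    fun hη => (contDiff_tailOne hu hη).continuous
  have c3 : ∀ {η : ℝ → V n}, ContDiff ℝ ∞ η → Continuous (tailTwo w u η) :=
    fun hη => (contDiff_tailTwo hw hu huU hη).continuous
  have split : ∀ {η ζ : ℝ → V n}, ContDiff ℝ ∞ η → ContDiff ℝ ∞ ζ → SuppIn R η → SuppIn R ζ →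
      pairing η ((conformalOp G w).op u ζ) =
        (∫ x in (-R)..R, η x ⬝ᵥ (G (u x) *ᵥ covAlong G u ζ x))
        + ((∫ x in (-R)..R, tailTwo w u η x * prim R (tailOne u ζ) x)
        + ∫ x in (-R)..R, tailOne u η x * prim R (tailTwo w u ζ) x) := by
    intro η ζ hη hζ hsη hsζ
    have i2 := ((c3 hη).fun_mul (continuous_prim R (c2 hζ))).intervalIntegrable
      (μ := MeasureTheory.volume) (-R) R
    have i3 := ((c2 hη).fun_mul (continuous_prim R (c3 hζ))).intervalIntegrable
      (μ := MeasureTheory.volume) (-R) R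
    rw [pairing_op_eq hw hu huU hζ hsη hsζ, intervalIntegral.integral_add
      ((c1 hη hζ).intervalIntegrable _ _) (i2.add i3), intervalIntegral.integral_add i2 i3]
  -- The symmetric part of the local term is a total derivative, by metric compatibility along the
  -- curve.
  have hder : ∀ x, HasDerivAt (fun x => η x ⬝ᵥ (G (u x) *ᵥ ζ x))
      (η x ⬝ᵥ (G (u x) *ᵥ covAlong G u ζ x) + ζ x ⬝ᵥ (G (u x) *ᵥ covAlong G u η x)) x := by
    intro x
    have hd : ∀ {f : ℝ → V n}, ContDiff ℝ ∞ f → HasDerivAt f (deriv f x) x :=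
      fun hf => (hf.differentiable (by simp) x).hasDerivAt
    refine (hasDerivAt_dotProduct (hd hη) (hasDerivAt_mulVec (M' := dmat G (u x) (deriv u x))
      (hasDerivAt_matrix_curve hU hG.smooth (hd hu) (huU x)) (hd hζ))).congr_deriv ?_
    have hg := hG.transpose_eq (huU x)
    have s1 := dotProduct_symm_mulVec hg (deriv η x) (ζ x)
    have s2 : ζ x ⬝ᵥ (G (u x) *ᵥ ((conn G (u x) (deriv u x))ᵀ *ᵥ η x)) =
        η x ⬝ᵥ (conn G (u x) (deriv u x) *ᵥ (G (u x) *ᵥ ζ x)) := by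
      rw [dotProduct_symm_mulVec hg, transpose_mulVec_dotProduct]
    simp only [dmat_metric hU hG (huU x), covAlong, Matrix.mulVec_sub, Matrix.add_mulVec,
      Matrix.neg_mulVec, dotProduct_sub, dotProduct_add, dotProduct_neg, ← Matrix.mulVec_mulVec]
    linear_combination s1 + s2
  have hloc := intervalIntegral.integral_eq_sub_of_hasDerivAt (a := -R) (b := R)
    (fun x _ => hder x) (((c1 hη hζ).add (c1 hζ hη)).intervalIntegrable _ _)
  rw [intervalIntegral.integral_add ((c1 hη hζ).intervalIntegrable _ _)
    ((c1 hζ hη).intervalIntegrable _ _), hsη R (by simp), hsη (-R) (by simp), zero_dotProduct,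
    zero_dotProduct, sub_zero] at hloc
  -- Skewness of the primitive exchanges the two tail terms: each is minus the other with `η` and
  -- `ζ` interchanged.
  rw [split hη hζ hsη hsζ, split hζ hη hsζ hsη, prim_skew R (c2 hζ) (c3 hη),
    prim_skew R (c3 hζ) (c2 hη)]
  linarith

/-- The pairing depends only on the field near the supports of the covectors. -/
theorem pairing_op_congr {u₁ u₂ : ℝ → V n} (hsη : SuppIn R η) (hsζ : SuppIn R ζ)
    (h : ∀ x ∈ Set.Ioo (-R) R, u₁ =ᶠ[𝓝 x] u₂) :
    pairing η ((conformalOp G w).op u₁ ζ) = pairing η ((conformalOp G w).op u₂ ζ) := by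
  have h1 : tailOne u₁ ζ = tailOne u₂ ζ := by
    funext x
    by_cases hx : x ∈ Set.Ioo (-R) R
    · simp only [tailOne, (h x hx).deriv_eq]
    · simp only [tailOne, hsζ x hx, zero_dotProduct]
  have h2 : tailTwo w u₁ ζ = tailTwo w u₂ ζ := by
    funext x
    by_cases hx : x ∈ Set.Ioo (-R) R
    · simp only [tailTwo, (h x hx).deriv_eq, (h x hx).eq_of_nhds]
    · simp only [tailTwo, hsζ x hx, zero_dotProduct]
  simp only [pairing_eq_dotProduct]
  congr 1
  funext x
  by_cases hx : x ∈ Set.Ioo (-R) R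
  · simp only [conformalOp_op_eq, covAlong, h1, h2, (h x hx).deriv_eq, (h x hx).eq_of_nhds]
  · simp only [hsη x hx, zero_dotProduct]

/-- A variation of the field can be cut off outside a compact interval, so that it
stays in `U`. -/
theorem exists_cutoff (hU : IsOpen U) (hu : ContDiff ℝ ∞ u) (huU : ∀ x, u x ∈ U) {X : ℝ → V n}
    (hX : ContDiff ℝ ∞ X) (R : ℝ) (hR : 0 < R) :
    ∃ (Z : ℝ → V n) (ρ : ℝ → ℝ), ContDiff ℝ ∞ Z ∧ ContDiff ℝ ∞ ρ ∧ (∀ᶠ ε in 𝓝 0, ρ ε = ε) ∧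
      (∀ x ∈ Set.Icc (-R) R, Z =ᶠ[𝓝 x] X) ∧ ∀ ε x, u x + ρ ε • Z x ∈ U := by
  -- The bump is `1` beyond `[-R, R]`, so the cut-off variation agrees with `X` near every point of
  -- the closed interval, derivatives included.
  let χ : ContDiffBump (0 : ℝ) := ⟨R + 1, R + 2, by linarith, by linarith⟩
  let Z : ℝ → V n := fun x => χ x • X x
  have hZ : ContDiff ℝ ∞ Z := χ.contDiff.smul hX
  have hZs : HasCompactSupport Z := χ.hasCompactSupport.smul_right
  obtain ⟨C, hC⟩ := hZ.continuous.bounded_above_of_compact_support hZs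
  have hK : IsCompact (u '' tsupport Z) := hZs.isCompact.image hu.continuous
  obtain ⟨δ, hδ, hδU⟩ := hK.exists_thickening_subset_open hU
    (Set.image_subset_iff.2 fun x _ => huU x)
  have hC0 : 0 ≤ C := (norm_nonneg _).trans (hC 0)
  -- With `C + 1` in place of `C` the division is legitimate even if `C = 0`, and `r C < δ` is
  -- strict.
  let r : ℝ := δ / (C + 1)
  have hr : 0 < r := by positivity
  -- The parameter is cut off as well: `χ' ε * ε` is `ε` near `0` and never exceeds `r` in absolute
  -- value, so the varied curve stays in `U` for every real `ε`.
  let χ' : ContDiffBump (0 : ℝ) := ⟨r / 2, r, by positivity, by linarith⟩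
  refine ⟨Z, fun ε => χ' ε * ε, hZ, χ'.contDiff.mul contDiff_id, ?_, ?_, ?_⟩
  · filter_upwards [χ'.eventuallyEq_one] with ε hε
    rw [hε]; simp
  · intro x hx
    have : ∀ᶠ y in 𝓝 x, y ∈ Metric.closedBall (0 : ℝ) (R + 1) := by
      refine Filter.eventually_of_mem (Ioo_mem_nhds (a := -(R + 1)) (b := R + 1)
        (by linarith [hx.1]) (by linarith [hx.2])) fun y hy => ?_
      rw [mem_closedBall_zero_iff, Real.norm_eq_abs, abs_le]
      exact ⟨hy.1.le, hy.2.le⟩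
    filter_upwards [this] with y hy
    have : χ y = 1 := χ.one_of_mem_closedBall hy
    simp [Z, this]
  · intro ε x
    by_cases hx : x ∈ tsupport Z
    · apply hδU
      rw [Metric.mem_thickening_iff]
      refine ⟨u x, Set.mem_image_of_mem u hx, ?_⟩
      rw [dist_eq_norm, add_sub_cancel_left, norm_smul, Real.norm_eq_abs]
      have hρ : |χ' ε * ε| ≤ r := by
        by_cases hε : |ε| < r
        · rw [abs_mul, abs_of_nonneg χ'.nonneg]
          nlinarith [χ'.le_one (x := ε), χ'.nonneg (x := ε), abs_nonneg ε]
        · have : χ' ε = 0 := χ'.zero_of_le_dist (by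
            rw [dist_zero_right, Real.norm_eq_abs]; exact not_lt.1 hε)
          rw [this]; simpa using hr.le
      calc |χ' ε * ε| * ‖Z x‖ ≤ r * C := mul_le_mul hρ (hC x) (norm_nonneg _) hr.le
        _ < r * (C + 1) := by nlinarith
        _ = δ := by simp only [r]; field_simp
    · rw [image_eq_zero_of_notMem_tsupport hx, smul_zero, add_zero]
      exact huU x

end ConformalOperator

/-! ### Linearization of the bracket and the Jacobi identity. -/

section Jacobi

variable {n : ℕ} {U : Set (V n)} {G w : V n → Matrix (Fin n) (Fin n) ℝ} {u : ℝ → V n}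
  {R : ℝ} {ξ η ζ : ℝ → V n}

/-- By `prim_skew`, a primitive of a varied function `f'` is traded for a primitive of the unvaried
factor `k`. After this the variation enters the linearized bracket only pointwise. -/
theorem integral_prim_swap (R : ℝ) {l k₁ k₁' k₀ k₀' f₀ f₀' f₁ f₁' : ℝ → ℝ} (hl : Continuous l)
    (hk₁ : Continuous k₁) (hk₁' : Continuous k₁') (hk₀ : Continuous k₀) (hk₀' : Continuous k₀')
    (hf₀ : Continuous f₀) (hf₀' : Continuous f₀') (hf₁ : Continuous f₁) (hf₁' : Continuous f₁') :
    ∫ x in (-R)..R, (l x + ((k₁' x * prim R f₀ x + k₁ x * prim R f₀' x)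
        + (k₀' x * prim R f₁ x + k₀ x * prim R f₁' x))) =
      ∫ x in (-R)..R, (l x + (k₁' x * prim R f₀ x - f₀' x * prim R k₁ x
        + k₀' x * prim R f₁ x - f₁' x * prim R k₀ x)) := by
  have s1 := prim_skew R hf₀' hk₁
  have s2 := prim_skew R hf₁' hk₀
  have c := @continuous_prim R
  have i : ∀ {f g : ℝ → ℝ}, Continuous f → Continuous g →
      IntervalIntegrable (fun x => f x * prim R g x) MeasureTheory.volume (-R) R :=
    fun hf hg => (hf.mul (c hg)).intervalIntegrable _ _
  rw [← sub_eq_zero, ← intervalIntegral.integral_sub]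
  · have e : ∀ x, (l x + ((k₁' x * prim R f₀ x + k₁ x * prim R f₀' x)
        + (k₀' x * prim R f₁ x + k₀ x * prim R f₁' x)))
        - (l x + (k₁' x * prim R f₀ x - f₀' x * prim R k₁ x
          + k₀' x * prim R f₁ x - f₁' x * prim R k₀ x)) =
        (k₁ x * prim R f₀' x + f₀' x * prim R k₁ x)
          + (k₀ x * prim R f₁' x + f₁' x * prim R k₀ x) := fun x => by ring
    simp only [e]
    rw [intervalIntegral.integral_add ((i hk₁ hf₀').add (i hf₀' hk₁))
      ((i hk₀ hf₁').add (i hf₁' hk₀)), intervalIntegral.integral_add (i hk₁ hf₀') (i hf₀' hk₁),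
      intervalIntegral.integral_add (i hk₀ hf₁') (i hf₁' hk₀)]
    linarith
  · exact (hl.intervalIntegrable _ _).add (((i hk₁' hf₀).add (i hk₁ hf₀')).add
      ((i hk₀' hf₁).add (i hk₀ hf₁')))
  · exact (hl.intervalIntegrable _ _).add ((((i hk₁' hf₀).sub (i hf₀' hk₁)).add
      (i hk₀' hf₁)).sub (i hf₁' hk₀))

/-- The integrand of the linearization of `∫ η · J(u) ζ` along the variation `Z` of `u`. -/
def linIntegrand (G w : V n → Matrix (Fin n) (Fin n) ℝ) (R : ℝ) (u Z η ζ : ℝ → V n) (x : ℝ) : ℝ :=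
  η x ⬝ᵥ (dmat G (u x) (Z x) *ᵥ covAlong G u ζ x - G (u x) *ᵥ
      ((dconn G (u x) (Z x) (deriv u x) + conn G (u x) (deriv Z x))ᵀ *ᵥ ζ x))
    + ((η x ⬝ᵥ (dmat w (u x) (Z x) *ᵥ deriv u x + w (u x) *ᵥ deriv Z x)) * prim R (tailOne u ζ) x
    - (ζ x ⬝ᵥ deriv Z x) * prim R (tailTwo w u η) x
    + (η x ⬝ᵥ deriv Z x) * prim R (tailTwo w u ζ) x
    - (ζ x ⬝ᵥ (dmat w (u x) (Z x) *ᵥ deriv u x + w (u x) *ᵥ deriv Z x)) * prim R (tailOne u η) x)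

theorem continuous_linIntegrand (hU : IsOpen U) (hG : IsMetric U G)
    (hw : ∀ i j, ContDiffOn ℝ ∞ (fun q => w q i j) U) (hu : ContDiff ℝ ∞ u)
    (huU : ∀ x, u x ∈ U) {Z : ℝ → V n} (hZ : ContDiff ℝ ∞ Z) (hη : ContDiff ℝ ∞ η)
    (hζ : ContDiff ℝ ∞ ζ) : Continuous (linIntegrand G w R u Z η ζ) := by
  have hu' := contDiff_deriv_curve hu
  have hZ' := contDiff_deriv_curve hZ
  have hdw : ContDiff ℝ ∞ (fun x => dmat w (u x) (Z x) *ᵥ deriv u x + w (u x) *ᵥ deriv Z x) :=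
    (contDiff_mulVec (contDiff_dmat hU hw hu huU hZ) hu').add
      (contDiff_mulVec (fun i j => contDiff_comp_field (hw i j) hu huU) hZ')
  have p1 : ∀ {η : ℝ → V n}, ContDiff ℝ ∞ η → ContDiff ℝ ∞ (prim R (tailOne u η)) :=
    fun hη => contDiff_prim R (contDiff_tailOne hu hη)
  have p2 : ∀ {η : ℝ → V n}, ContDiff ℝ ∞ η → ContDiff ℝ ∞ (prim R (tailTwo w u η)) :=
    fun hη => contDiff_prim R (contDiff_tailTwo hw hu huU hη)
  have hloc : ContDiff ℝ ∞ (fun x => η x ⬝ᵥ (dmat G (u x) (Z x) *ᵥ covAlong G u ζ x - G (u x) *ᵥ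
      ((dconn G (u x) (Z x) (deriv u x) + conn G (u x) (deriv Z x))ᵀ *ᵥ ζ x))) := by
    refine contDiff_dotProduct hη ((contDiff_mulVec (contDiff_dmat hU hG.smooth hu huU hZ)
      (contDiff_covAlong hU hG hu huU hζ)).sub
      (contDiff_mulVec (fun i j => contDiff_comp_field (hG.smooth i j) hu huU)
        (contDiff_mulVec (fun i j => ?_) hζ)))
    exact (contDiff_dconn hU hG hu huU hZ hu' j i).add (contDiff_conn hU hG hu huU hZ' j i)
  exact (hloc.add (((((contDiff_dotProduct hη hdw).mul (p1 hζ)).sub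
    ((contDiff_dotProduct hζ hZ').mul (p2 hη))).add ((contDiff_dotProduct hη hZ').mul (p2 hζ))).sub
    ((contDiff_dotProduct hζ hdw).mul (p1 hη)))).continuous

/-- The reparametrization `ρ` makes the family smooth and `U`-valued on the whole `(ε, x)`-plane, so
differentiation under the integral and under the primitives is allowed everywhere; `ρ ε = ε` near
`0` keeps the derivative at `0` the intended one. -/
theorem hasDerivAt_pairing_op (hU : IsOpen U) (hG : IsMetric U G)
    (hw : ∀ i j, ContDiffOn ℝ ∞ (fun q => w q i j) U) (hu : ContDiff ℝ ∞ u)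
    {Z : ℝ → V n} (hZ : ContDiff ℝ ∞ Z) {ρ : ℝ → ℝ} (hρ : ContDiff ℝ ∞ ρ)
    (hρ0 : ∀ᶠ ε in 𝓝 0, ρ ε = ε) (hUρ : ∀ ε x, u x + ρ ε • Z x ∈ U)
    (hη : ContDiff ℝ ∞ η) (hζ : ContDiff ℝ ∞ ζ) (hsη : SuppIn R η) (hsζ : SuppIn R ζ) :
    HasDerivAt (fun ε => pairing η ((conformalOp G w).op (fun x => u x + ρ ε • Z x) ζ))
      (∫ x in (-R)..R, linIntegrand G w R u Z η ζ x) 0 := by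
  have hu' := contDiff_deriv_curve hu
  have hZ' := contDiff_deriv_curve hZ
  have hρz : ρ 0 = 0 := hρ0.self_of_nhds
  have hρd : HasDerivAt ρ 1 0 := (hasDerivAt_id 0).congr_of_eventuallyEq hρ0
  let γ : ℝ × ℝ → V n := fun z => u z.2 + ρ z.1 • Z z.2
  let Y : ℝ × ℝ → V n := fun z => deriv u z.2 + ρ z.1 • deriv Z z.2
  have sc : ∀ {η : ℝ → V n}, ContDiff ℝ ∞ η → ContDiff ℝ ∞ (fun z : ℝ × ℝ => η z.2) :=
    fun hη => hη.comp contDiff_snd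
  have hγ : ContDiff ℝ ∞ γ := (sc hu).add ((hρ.comp contDiff_fst).smul (sc hZ))
  have hY : ContDiff ℝ ∞ Y := (sc hu').add ((hρ.comp contDiff_fst).smul (sc hZ'))
  have hγU : ∀ z, γ z ∈ U := fun z => hUρ z.1 z.2
  have hγx : ∀ ε x, deriv (fun x => γ (ε, x)) x = Y (ε, x) := fun ε x =>
    ((hu.differentiable (by simp) x).hasDerivAt.add
      ((hZ.differentiable (by simp) x).hasDerivAt.const_smul (ρ ε))).deriv
  have hγs : ∀ ε, ContDiff ℝ ∞ (fun x => γ (ε, x)) := fun ε => hu.add (hZ.const_smul (ρ ε))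
  have hγ0 : ∀ x, γ (0, x) = u x := fun x => by simp [γ, hρz]
  have hY0 : ∀ x, Y (0, x) = deriv u x := fun x => by simp [Y, hρz]
  have hγε : ∀ x, HasDerivAt (fun ε => γ (ε, x)) (Z x) 0 := fun x =>
    ((hρd.smul_const (Z x)).const_add (u x)).congr_deriv (one_smul ℝ _)
  have hYε : ∀ x, HasDerivAt (fun ε => Y (ε, x)) (deriv Z x) 0 := fun x =>
    ((hρd.smul_const (deriv Z x)).const_add (deriv u x)).congr_deriv (one_smul ℝ _)
  have hwY : ContDiff ℝ ∞ (fun z => w (γ z) *ᵥ Y z) :=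
    contDiff_mulVec (fun i j => contDiff_comp_field (hw i j) hγ hγU) hY
  have hwYε : ∀ x, HasDerivAt (fun ε => w (γ (ε, x)) *ᵥ Y (ε, x))
      (dmat w (u x) (Z x) *ᵥ deriv u x + w (u x) *ᵥ deriv Z x) 0 := by
    intro x
    have h := hasDerivAt_mulVec (hasDerivAt_matrix_curve hU hw (hγε x) (hγU _)) (hYε x)
    simpa only [hγ0, hY0] using h
  let L : ℝ × ℝ → ℝ := fun z => η z.2 ⬝ᵥ (G (γ z) *ᵥ (deriv ζ z.2 - (conn G (γ z) (Y z))ᵀ *ᵥ ζ z.2))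
  have hL : ContDiff ℝ ∞ L := contDiff_dotProduct (sc hη)
    (contDiff_mulVec (fun i j => contDiff_comp_field (hG.smooth i j) hγ hγU)
      ((sc (contDiff_deriv_curve hζ)).sub
        (contDiff_mulVec (fun i j => contDiff_conn hU hG hγ hγU hY j i) (sc hζ))))
  have dL : ∀ x, deriv (fun ε => L (ε, x)) 0 =
      η x ⬝ᵥ (dmat G (u x) (Z x) *ᵥ covAlong G u ζ x - G (u x) *ᵥ
      ((dconn G (u x) (Z x) (deriv u x) + conn G (u x) (deriv Z x))ᵀ *ᵥ ζ x)) := by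
    intro x
    have h1 := hasDerivAt_mulVec (M := fun ε => (conn G (γ (ε, x)) (Y (ε, x)))ᵀ)
      (M' := (dconn G (γ (0, x)) (Z x) (Y (0, x)) + conn G (γ (0, x)) (deriv Z x))ᵀ)
      (fun i j => hasDerivAt_conn_curve hU hG (hγε x) (hYε x) (hγU _) j i)
      (hasDerivAt_const 0 (ζ x))
    have h2 := hasDerivAt_mulVec (hasDerivAt_matrix_curve hU hG.smooth (hγε x) (hγU _))
      (h1.const_sub (deriv ζ x))
    have h3 := hasDerivAt_dotProduct (hasDerivAt_const 0 (η x)) h2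
    refine h3.deriv.trans ?_
    simp only [hγ0, hY0, covAlong, zero_dotProduct, zero_add, Matrix.mulVec_zero, add_zero,
      Matrix.mulVec_neg, sub_eq_add_neg]
  have dY : ∀ (η : ℝ → V n) (x : ℝ),
      deriv (fun ε => η x ⬝ᵥ Y (ε, x)) 0 = η x ⬝ᵥ deriv Z x := fun η x => by
    simpa using (hasDerivAt_dotProduct (hasDerivAt_const 0 (η x)) (hYε x)).deriv
  have dwY : ∀ (η : ℝ → V n) (x : ℝ), deriv (fun ε => η x ⬝ᵥ (w (γ (ε, x)) *ᵥ Y (ε, x))) 0 =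
      η x ⬝ᵥ (dmat w (u x) (Z x) *ᵥ deriv u x + w (u x) *ᵥ deriv Z x) := fun η x => by
    rw [(hasDerivAt_dotProduct (hasDerivAt_const 0 (η x)) (hwYε x)).deriv, zero_dotProduct,
      zero_add]
  have fK₁ := HasFamilyDeriv.of_contDiff (contDiff_dotProduct (sc hη) hwY)
  have fK₀ := HasFamilyDeriv.of_contDiff (contDiff_dotProduct (sc hη) hY)
  have fF₁ := HasFamilyDeriv.of_contDiff (contDiff_dotProduct (sc hζ) hwY)
  have fF₀ := HasFamilyDeriv.of_contDiff (contDiff_dotProduct (sc hζ) hY)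
  have fL := HasFamilyDeriv.of_contDiff hL
  have main := (fL.add ((fK₁.mul (fF₀.prim R)).add (fK₀.mul (fF₁.prim R)))).hasDerivAt_integral
    (-R) R 0
  have e1 : (fun ε => pairing η ((conformalOp G w).op (fun x => u x + ρ ε • Z x) ζ)) =
      fun ε => ∫ x in (-R)..R, (L (ε, x) + (η x ⬝ᵥ (w (γ (ε, x)) *ᵥ Y (ε, x))
        * prim R (fun x => ζ x ⬝ᵥ Y (ε, x)) x + η x ⬝ᵥ Y (ε, x)
        * prim R (fun x => ζ x ⬝ᵥ (w (γ (ε, x)) *ᵥ Y (ε, x))) x)) := by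
    funext ε
    have h1 : ∀ ζ : ℝ → V n, tailOne (fun x => γ (ε, x)) ζ = fun x => ζ x ⬝ᵥ Y (ε, x) :=
      fun ζ => funext fun x => by rw [tailOne, hγx]
    have h2 : ∀ ζ : ℝ → V n, tailTwo w (fun x => γ (ε, x)) ζ =
        fun x => ζ x ⬝ᵥ (w (γ (ε, x)) *ᵥ Y (ε, x)) :=
      fun ζ => funext fun x => by rw [tailTwo, hγx]
    have h3 := pairing_op_eq (G := G) hw (hγs ε) (fun x => hγU (ε, x)) hζ hsη hsζ
    simp only [h1, h2, covAlong, hγx] at h3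
    exact h3
  rw [e1]
  refine main.congr_deriv ?_
  refine (integral_prim_swap R (fL.cont_left' 0) (fK₁.cont_left 0) (fK₁.cont_left' 0)
    (fK₀.cont_left 0) (fK₀.cont_left' 0) (fF₀.cont_left 0) (fF₀.cont_left' 0) (fF₁.cont_left 0)
    (fF₁.cont_left' 0)).trans ?_
  congr 1
  funext x
  simp only [dL, dY, dwY, hγ0, hY0]
  rfl

/-- This is `bracket_integrand_eq` along the curve. Every term of the differentiated function has
`η` or `ζ` as a pointwise factor and therefore vanishes at `±R`. -/
theorem bracket_integrand_hasDerivAt (hU : IsOpen U) (hG : IsMetric U G)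
    (hw : ∀ i j, ContDiffOn ℝ ∞ (fun q => w q i j) U)
    (hcod : ∀ p ∈ U, ∀ i j k : Fin n, covDeriv G w p k i j = covDeriv G w p j i k)
    (hR : ∀ p ∈ U, HasConformalCurvature G w p) (hu : ContDiff ℝ ∞ u)
    (huU : ∀ x, u x ∈ U) {X : ℝ → V n} (hX : ContDiff ℝ ∞ X) (hη : ContDiff ℝ ∞ η)
    (hζ : ContDiff ℝ ∞ ζ) (hsη : SuppIn R η) (hsζ : SuppIn R ζ) (x : ℝ) :
    HasDerivAt (fun x => -(η x ⬝ᵥ (G (u x) *ᵥ ((conn G (u x) (X x))ᵀ *ᵥ ζ x)))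
        + (η x ⬝ᵥ (w (u x) *ᵥ X x)) * prim R (tailOne u ζ) x
        - (ζ x ⬝ᵥ (w (u x) *ᵥ X x)) * prim R (tailOne u η) x
        + (η x ⬝ᵥ X x) * prim R (tailTwo w u ζ) x
        - (ζ x ⬝ᵥ X x) * prim R (tailTwo w u η) x)
      (linIntegrand G w R u X η ζ x - bracketRemainder (w (u x)) (conn G (u x) (X x)) (X x)
        (η x) (ζ x) (covAlong G u η x) (covAlong G u ζ x)
        ((conformalOp G w).op u η x) ((conformalOp G w).op u ζ x)
        (prim R (tailOne u η) x) (prim R (tailOne u ζ) x)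
        (prim R (tailTwo w u η) x) (prim R (tailTwo w u ζ) x)) x := by
  have hd : ∀ {f : ℝ → V n}, ContDiff ℝ ∞ f → HasDerivAt f (deriv f x) x :=
    fun hf => (hf.differentiable (by simp) x).hasDerivAt
  have p1 : ∀ {η : ℝ → V n}, ContDiff ℝ ∞ η → HasDerivAt (prim R (tailOne u η)) (tailOne u η x) x :=
    fun hη => hasDerivAt_prim R (contDiff_tailOne hu hη).continuous x
  have p2 : ∀ {η : ℝ → V n}, ContDiff ℝ ∞ η →
      HasDerivAt (prim R (tailTwo w u η)) (tailTwo w u η x) x :=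
    fun hη => hasDerivAt_prim R (contDiff_tailTwo hw hu huU hη).continuous x
  have hwX := hasDerivAt_mulVec (hasDerivAt_matrix_curve hU hw (hd hu) (huU x)) (hd hX)
  have hC := hasDerivAt_mulVec (M := fun x => (conn G (u x) (X x))ᵀ)
    (M' := (dconn G (u x) (deriv u x) (X x) + conn G (u x) (deriv X x))ᵀ)
    (fun i j => hasDerivAt_conn_curve hU hG (hd hu) (hd hX) (huU x) j i) (hd hζ)
  have hT := ((((hasDerivAt_dotProduct (hd hη) (hasDerivAt_mulVec
    (hasDerivAt_matrix_curve hU hG.smooth (hd hu) (huU x)) hC)).fun_neg.fun_add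
    ((hasDerivAt_dotProduct (hd hη) hwX).fun_mul (p1 hζ))).fun_sub
    ((hasDerivAt_dotProduct (hd hζ) hwX).fun_mul (p1 hη))).fun_add
    ((hasDerivAt_dotProduct (hd hη) (hd hX)).fun_mul (p2 hζ))).fun_sub
    ((hasDerivAt_dotProduct (hd hζ) (hd hX)).fun_mul (p2 hη))
  refine hT.congr_deriv ?_
  rw [eq_sub_iff_add_eq, linIntegrand, conformalOp_op_eq_prim hw hu huU hη hsη,
    conformalOp_op_eq_prim hw hu huU hζ hsζ, dmat_metric hU hG (huU x), dmat_metric hU hG (huU x)]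
  exact (bracket_integrand_eq (hG.transpose_eq (huU x))
    (dmat_codazzi hU hG (huU x) (hcod _ (huU x)) (X x) (deriv u x))
    (conn_mulVec_comm hU hG (huU x) (X x) (deriv u x))
    (dotProduct_curvature hU hG (huU x) (hR _ (huU x)) (η x) (ζ x) (X x) (deriv u x))).symm

/-- An operator of conformally flat type whose affinor is symmetric and satisfies the Codazzi
equation and the equation for the curvature is Hamiltonian. -/
theorem isHamiltonianOperator_conformalOp (hU : IsOpen U) (hG : IsMetric U G)
    (hw : ∀ i j, ContDiffOn ℝ ∞ (fun q => w q i j) U)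
    (hsym : ∀ p ∈ U, ((G p)⁻¹ * w p).IsSymm)
    (hcod : ∀ p ∈ U, ∀ i j k : Fin n, covDeriv G w p k i j = covDeriv G w p j i k)
    (hR : ∀ p ∈ U, HasConformalCurvature G w p) :
    IsHamiltonianOperator U (conformalOp G w).op := by
  intro u hu huU
  refine ⟨?_, ?_, ?_⟩
  · rintro ξ ⟨hξ, hξs⟩
    obtain ⟨R, -, hs⟩ := exists_suppIn hξs
    exact contDiff_conformalOp_op hU hG hw hu huU hξ (hs R le_rfl)
  · rintro ξ η ⟨hξ, hξs⟩ ⟨hη, hηs⟩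
    obtain ⟨R₁, -, hs₁⟩ := exists_suppIn hξs
    obtain ⟨R₂, -, hs₂⟩ := exists_suppIn hηs
    exact pairing_op_skew hU hG hw hu huU hξ hη (hs₁ _ (le_max_left R₁ R₂))
      (hs₂ _ (le_max_right R₁ R₂))
  · rintro ξ η ζ ⟨hξ, hξs⟩ ⟨hη, hηs⟩ ⟨hζ, hζs⟩
    obtain ⟨R₁, hR₁, hs₁⟩ := exists_suppIn hξs
    obtain ⟨R₂, -, hs₂⟩ := exists_suppIn hηs
    obtain ⟨R₃, -, hs₃⟩ := exists_suppIn hζs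
    obtain ⟨R, h1, h2, h3⟩ : ∃ R, R₁ ≤ R ∧ R₂ ≤ R ∧ R₃ ≤ R :=
      ⟨max R₁ (max R₂ R₃), by simp, by simp, by simp⟩
    have hRpos : 0 < R := hR₁.trans_le h1
    replace hs₁ := hs₁ R h1
    replace hs₂ := hs₂ R h2
    replace hs₃ := hs₃ R h3
    have smooth : ∀ {ξ : ℝ → V n}, ContDiff ℝ ∞ ξ → SuppIn R ξ →
        ContDiff ℝ ∞ ((conformalOp G w).op u ξ) :=
      fun hξ hs => contDiff_conformalOp_op hU hG hw hu huU hξ hs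
    have deriv_bracket : ∀ {ξ η ζ : ℝ → V n}, ContDiff ℝ ∞ ξ → ContDiff ℝ ∞ η → ContDiff ℝ ∞ ζ →
        SuppIn R ξ → SuppIn R η → SuppIn R ζ →
        HasDerivAt (fun ε : ℝ => pairing η
          ((conformalOp G w).op (u + ε • (conformalOp G w).op u ξ) ζ))
          (∫ x in (-R)..R, linIntegrand G w R u ((conformalOp G w).op u ξ) η ζ x) 0 := by
      intro ξ η ζ hξ hη hζ hsξ hsη hsζ
      -- The value `J(u) ξ` need not have compact support, since the primitives are constants
      -- outside the support of `ξ`; hence `u + ε J(u) ξ` may leave `U` for arbitrarily small `ε`.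
      -- The pairing sees the field only near the points of `(-R, R)`, so a cut-off variation gives
      -- the same derivative.
      obtain ⟨Z, ρ, hZ, hρ, hρ0, hZX, hUρ⟩ := exists_cutoff hU hu huU (smooth hξ hsξ) R hRpos
      have h := hasDerivAt_pairing_op hU hG hw hu hZ hρ hρ0 hUρ hη hζ hsη hsζ
      refine (h.congr_of_eventuallyEq ?_).congr_deriv ?_
      · filter_upwards [hρ0] with ε hε
        refine pairing_op_congr hsη hsζ fun x hx => ?_
        filter_upwards [hZX x (Set.Ioo_subset_Icc_self hx)] with y hy
        simp [hy, hε]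
      · refine intervalIntegral.integral_congr fun x hx => ?_
        rw [Set.uIcc_of_le (by linarith)] at hx
        simp only [linIntegrand, (hZX x hx).eq_of_nhds, (hZX x hx).deriv_eq]
    refine ⟨_, _, _, deriv_bracket hξ hη hζ hs₁ hs₂ hs₃, deriv_bracket hη hζ hξ hs₂ hs₃ hs₁,
      deriv_bracket hζ hξ hη hs₃ hs₁ hs₂, ?_⟩
    have hint : ∀ {ξ η ζ : ℝ → V n}, ContDiff ℝ ∞ ξ → ContDiff ℝ ∞ η → ContDiff ℝ ∞ ζ →
        SuppIn R ξ → IntervalIntegrable (linIntegrand G w R u ((conformalOp G w).op u ξ) η ζ)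
          MeasureTheory.volume (-R) R := fun hξ hη hζ hs =>
      (continuous_linIntegrand hU hG hw hu huU (smooth hξ hs) hη hζ).intervalIntegrable _ _
    have i1 := hint hξ hη hζ hs₁
    have i2 := hint hη hζ hξ hs₂
    have i3 := hint hζ hξ hη hs₃
    rw [← intervalIntegral.integral_add i1 i2, ← intervalIntegral.integral_add (i1.add i2) i3]
    have D := fun x => ((bracket_integrand_hasDerivAt hU hG hw hcod hR hu huU (smooth hξ hs₁)
      hη hζ hs₂ hs₃ x).fun_add (bracket_integrand_hasDerivAt hU hG hw hcod hR hu huU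
        (smooth hη hs₂) hζ hξ hs₃ hs₁ x)).fun_add (bracket_integrand_hasDerivAt hU hG hw hcod hR hu
        huU (smooth hζ hs₃) hξ hη hs₁ hs₂ x)
    -- The symmetry of the affinor with lowered index is turned into that with raised index, by
    -- multiplying with `G` on both sides.
    have hwG : ∀ p ∈ U, (w p * G p)ᵀ = w p * G p := by
      intro p hp
      have h := hsym p hp
      have h' : (w p)ᵀ * (G p)⁻¹ = (G p)⁻¹ * w p := by
        have hi : ((G p)⁻¹)ᵀ = (G p)⁻¹ := by
          rw [Matrix.transpose_nonsing_inv, hG.transpose_eq hp]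
        rw [← h.eq, Matrix.transpose_mul, hi]
      calc (w p * G p)ᵀ = G p * ((w p)ᵀ * (G p)⁻¹) * G p := by
            rw [Matrix.transpose_mul, hG.transpose_eq hp, Matrix.mul_assoc, Matrix.mul_assoc,
              hG.inv_mul hp, Matrix.mul_one]
        _ = w p * G p := by
            rw [h', ← Matrix.mul_assoc, hG.mul_inv hp, Matrix.one_mul]
    have cyc : ∀ x, _ := fun x => bracketRemainder_cyclic (C := conn G (u x))
      (hG.transpose_eq (huU x)) (hwG _ (huU x)) (conn_mulVec_comm hU hG (huU x))
      (ξ := ξ x) (η := η x) (ζ := ζ x) (conformalOp_op_eq_prim hw hu huU hξ hs₁ x)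
      (conformalOp_op_eq_prim hw hu huU hη hs₂ x) (conformalOp_op_eq_prim hw hu huU hζ hs₃ x)
    -- The remainders sum to zero pointwise, so the sum of the three integrands is an exact
    -- derivative.
    rw [intervalIntegral.integral_eq_sub_of_hasDerivAt
      (fun x _ => (D x).congr_deriv (by linear_combination -cyc x)) ((i1.add i2).add i3)]
    have hz : ∀ {ξ : ℝ → V n}, SuppIn R ξ → ξ R = 0 ∧ ξ (-R) = 0 :=
      fun hs => ⟨hs R (by simp), hs (-R) (by simp)⟩
    simp only [hz hs₁, hz hs₂, hz hs₃, zero_dotProduct]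
    simp

end Jacobi

end HydroRecip

end

/-! ### The theorem. -/

open HydroRecip in
theorem theorem2 (n : ℕ) (U : Set (V n)) (hU : IsOpen U)
    (G : V n → Matrix (Fin n) (Fin n) ℝ) (hG : IsMetric U G) (hflat : IsFlat U G)
    (h B A : V n → ℝ) (hh : ContDiffOn ℝ ∞ h U) (hB : ContDiffOn ℝ ∞ B U)
    (hA : ContDiffOn ℝ ∞ A U) (hB0 : ∀ p ∈ U, B p ≠ 0)
    (v : V n → Matrix (Fin n) (Fin n) ℝ)
    (hv : IsHamiltonianSystem U v (localOp G) h ![])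
    (hcons : IsConservationLaw U v B A) :
    -- the reciprocal transformation takes the system to the one with the matrix `B v - A E`
    (∀ (D : Set (ℝ × ℝ)) (u : ℝ × ℝ → V n) (X : ℝ × ℝ → ℝ) (u' : ℝ × ℝ → V n),
      IsSolution U v D u → IsReciprocal B A D u X u' →
        IsSolution U (newMatrix v B A) ((fun z => (X z, z.2)) '' D) u') ∧
    -- the new operator is Hamiltonian
    IsMetric U (newMetric G B) ∧
    IsHamiltonianOperator U (conformalOp (newMetric G B) (newTail G B)).op ∧
    -- the transformed system is Hamiltonian with it, with the density `h / B`
    (∃ P : V n → ℝ, IsHamiltonianSystem U (newMatrix v B A)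
      (conformalOp (newMetric G B) (newTail G B)) (fun p => h p / B p)
      ![fun p => h p / B p, P]) ∧
    -- the new metric is conformally flat, and the new operator of conformally flat type
    IsConformallyFlat U (newMetric G B) ∧
    (∀ p ∈ U, ((newMetric G B p)⁻¹ * newTail G B p).IsSymm) ∧
    (∀ p ∈ U, ∀ i j k : Fin n, covDeriv (newMetric G B) (newTail G B) p k i j =
      covDeriv (newMetric G B) (newTail G B) p j i k) ∧
    (∀ p ∈ U, ∀ i j k l : Fin n, curvature (newMetric G B) p i j k l =
      newTail G B p i k * (1 : Matrix (Fin n) (Fin n) ℝ) j l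
      + newTail G B p j l * (1 : Matrix (Fin n) (Fin n) ℝ) i k
      - newTail G B p j k * (1 : Matrix (Fin n) (Fin n) ℝ) i l
      - newTail G B p i l * (1 : Matrix (Fin n) (Fin n) ℝ) j k) := by
  -- The Hamiltonian form of the given system is used only through this value of its matrix.
  have hvh : ∀ p ∈ U, v p = hess G h p := fun p hp => eq_hess_of_isHamiltonianSystem hU hh hv hp
  exact ⟨fun D u X u' hu hR => hR.isSolution hu hB hA hB0,
    isMetric_newMetric hG hB hB0,
    isHamiltonianOperator_conformalOp hU (isMetric_newMetric hG hB hB0)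
      (contDiffOn_newTail hU hG hB)
      (fun p hp => newMetric_inv_mul_newTail_isSymm hU hG hB hB0 hp)
      (fun p hp i j k => covDeriv_newTail hU hG hflat hB hB0 hp i j k)
      (fun p hp i j k l => curvature_newMetric hU hG hflat hB hB0 hp i j k l),
    ⟨_, isHamiltonianSystem_newMatrix hU hG hh hB hA hB0 hvh hcons⟩,
    isConformallyFlat_newMetric hU hG hflat hB hB0,
    fun p hp => newMetric_inv_mul_newTail_isSymm hU hG hB hB0 hp,
    fun p hp i j k => covDeriv_newTail hU hG hflat hB hB0 hp i j k,
    fun p hp i j k l => curvature_newMetric hU hG hflat hB hB0 hp i j k l⟩
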